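/- Let $B=\{z\in\mathbb C^n:|z|<1\}$ be the unit ball, and for $P\in\partial B$ and $\alpha>1$ let $$\mathcal A_\alpha(P)=\{z\in B:\ |1-z\cdot\overline P|<\alpha(1-|z|)\},\qquad z\cdot\overline P=\sum_{j=1}^n z_j\overline{P_j}.$$ A function $f:B\to\mathbb C$ is called admissibly bounded at $P$ if there is an $\alpha=\alpha(P)>1$ such that $f$ is bounded on $\mathcal A_\alpha(P)$; it is said to have an admissible limit at $P$ if for every $\alpha>1$ the limit $\lim_{\mathcal A_\alpha(P)\ni z\to P}f(z)$ exists in $\mathbb C$. Theorem. Let $f$ be holomorphic on $B$, and let $E\subseteq\partial B$ be a set of positive $(2n-1)$-dimensional Hausdorff measure. If $f$ is admissibly bounded at almost every point of $E$ (with respect to this measure), then $f$ has an admissible limit at almost every point of $E$. -/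

import Mathlib

open Set Filter Topology MeasureTheory

/-- The admissible approach region
`𝒜_α(P) = {z ∈ B : |1 - z · P̄| < α (1 - |z|)}` in the unit ball `B` of `ℂⁿ`.
Mathlib's inner product is conjugate-linear in its first argument, so
`inner ℂ P z = ∑ j, z j * conj (P j) = z · P̄`. -/
def admissibleRegion {n : ℕ} (α : ℝ) (P : EuclideanSpace ℂ (Fin n)) :
    Set (EuclideanSpace ℂ (Fin n)) :=
  {z | z ∈ Metric.ball (0 : EuclideanSpace ℂ (Fin n)) 1 ∧
    ‖1 - inner ℂ P z‖ < α * (1 - ‖z‖)}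

/-- `f` is admissibly bounded at `P`: it is bounded on `𝒜_α(P)` for some `α > 1`
(both `α` and the bound may depend on `P`). -/
def AdmissiblyBoundedAt {n : ℕ} (f : EuclideanSpace ℂ (Fin n) → ℂ)
    (P : EuclideanSpace ℂ (Fin n)) : Prop :=
  ∃ α : ℝ, 1 < α ∧ ∃ M : ℝ, ∀ z ∈ admissibleRegion α P, ‖f z‖ ≤ M

/-- `f` has an admissible limit at `P`: for every `α > 1`, the (finite) limit of `f z`
as `z → P` within `𝒜_α(P)` exists. -/
def HasAdmissibleLimitAt {n : ℕ} (f : EuclideanSpace ℂ (Fin n) → ℂ)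
    (P : EuclideanSpace ℂ (Fin n)) : Prop :=
  ∀ α : ℝ, 1 < α → ∃ l : ℂ, Tendsto f (𝓝[admissibleRegion α P] P) (𝓝 l)

/-! The proof combines one-variable radial limits with a density argument in the geometry adapted to
admissible regions.

Radial limits: restricted to a complex line through the origin, an admissible region becomes a Stolz
region, so Privalov's theorem in the disc gives radial limits at almost every angle of each circle
orbit. Integrating over the orbits gives them at almost every point of the sphere where `f` is
admissibly bounded (`ae_mem_radialSet`). Privalov's theorem is proved through a primitive `H`. A
bounded derivative on cones over `K` gives `H` locally Lipschitz boundary values on `K`, which are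
differentiable almost everywhere. At a density point of differentiability, `H` minus its first-order
part is `O(t)` on a square of size `t` and `o(t)` on its bottom side. Multiplying four rotated
copies and applying the maximum principle gives `o(t)` inside, and Cauchy's estimate turns this into
convergence of `H'`.

Admissible limits: the sphere carries the metric `√|1 - ⟨P, Q⟩|`, whose balls of radius `√h` are
comparable to the shadows of ellipsoids of size `h` in one complex direction and `√h` in the others.
Surface measure is doubling for it, so Lebesgue's density theorem holds. Take a density point of a
closed set of points sharing a bound for `f`, an aperture, and a constant `c` that is radially
`ε`-approximated from a common radius on. Over an admissible region of any aperture, `f` is then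
bounded on the ellipsoid about `z` and `ε`-close to `c` off a small proportion of it; the sub-mean
value property gives `|f z - c| ≤ 2ε`. Countably many such sets exhaust the points considered, and
the Cauchy criterion concludes.

Finally, a surface-null set spans a Lebesgue-null cone, hence is null for the Hausdorff measure. -/

/-! ### Uniform density theorems in doubling spaces. -/

/-- A form of Lebesgue's density theorem which is uniform over all small balls that are not too far
from the given point relative to their radius. -/
theorem ae_eventually_lt_measure_inter_div {α : Type*} [PseudoMetricSpace α]
    [MeasurableSpace α] (μ : Measure α) [IsUnifLocDoublingMeasure μ] [SecondCountableTopology α]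
    [BorelSpace α] [IsLocallyFiniteMeasure μ] (S : Set α) :
    ∀ᵐ x ∂μ, x ∈ S → ∀ C : ℝ, ∀ q < (1 : ENNReal), ∀ᶠ r in 𝓝[>] (0 : ℝ), ∀ y, dist x y ≤ C * r →
      q < μ (S ∩ Metric.closedBall y r) / μ (Metric.closedBall y r) := by
  refine ae_imp_of_ae_restrict ?_
  have h := ae_all_iff.2 fun k : ℕ =>
    IsUnifLocDoublingMeasure.ae_tendsto_measure_inter_div μ S (k : ℝ)
  filter_upwards [h] with x hx C q hq
  obtain ⟨k, hk⟩ := exists_nat_ge C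
  -- Convergence along this filter on pairs (centre, radius) is exactly convergence uniform in the
  -- centre.
  let l : Filter (α × ℝ) := comap Prod.snd (𝓝[>] 0) ⊓ 𝓟 {p | dist x p.1 ≤ C * p.2}
  have hl : Tendsto (Prod.snd : α × ℝ → ℝ) l (𝓝[>] 0) := tendsto_comap.mono_left inf_le_left
  have hev : ∀ᶠ p : α × ℝ in l, x ∈ Metric.closedBall p.1 (k * p.2) := by
    filter_upwards [hl self_mem_nhdsWithin, mem_inf_of_right (mem_principal_self _)] with p hp hp'
    rw [Metric.mem_closedBall]
    have hp0 : 0 < p.2 := hp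
    exact le_trans hp' (by gcongr)
  have ht := hx k (fun p : α × ℝ => p.1) (fun p => p.2) hl hev
  have hne := ht.eventually_const_lt hq
  rw [eventually_inf_principal, eventually_comap] at hne
  filter_upwards [hne] with r hr y hy using hr (y, r) rfl hy

/-- Almost every point `x` of `S` is such that all small balls which are not too far from `x`
relative to their radius meet `S`. -/
theorem ae_eventually_inter_closedBall_nonempty {α : Type*} [PseudoMetricSpace α]
    [MeasurableSpace α] (μ : Measure α) [IsUnifLocDoublingMeasure μ] [SecondCountableTopology α]
    [BorelSpace α] [IsLocallyFiniteMeasure μ] (S : Set α) :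
    ∀ᵐ x ∂μ, x ∈ S → ∀ C : ℝ, ∀ᶠ r in 𝓝[>] (0 : ℝ), ∀ y, dist x y ≤ C * r →
      (S ∩ Metric.closedBall y r).Nonempty := by
  filter_upwards [ae_eventually_lt_measure_inter_div μ S] with x hx hxS C
  filter_upwards [hx hxS C 0 one_pos] with r hr y hy
  by_contra hcon
  rw [not_nonempty_iff_eq_empty] at hcon
  simpa [hcon] using hr y hy

/-- Near almost every point of a measurable set, the complement of the set has small proportion in
all small balls which are not too far from the point relative to their radius. -/
theorem ae_eventually_measureReal_diff_le {α : Type*} [PseudoMetricSpace α]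
    [MeasurableSpace α] (μ : Measure α) [IsUnifLocDoublingMeasure μ] [SecondCountableTopology α]
    [BorelSpace α] [IsFiniteMeasure μ] {S : Set α} (hS : MeasurableSet S) :
    ∀ᵐ x ∂μ, x ∈ S → ∀ C : ℝ, ∀ η > (0 : ℝ), ∀ᶠ r in 𝓝[>] (0 : ℝ), ∀ y, dist x y ≤ C * r →
      μ.real (Metric.closedBall y r \ S) ≤ η * μ.real (Metric.closedBall y r) := by
  filter_upwards [ae_eventually_lt_measure_inter_div μ S] with x hx hxS C η hη
  have hq : ENNReal.ofReal (1 - η) < 1 := by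
    rw [ENNReal.ofReal_lt_one]; linarith
  filter_upwards [hx hxS C _ hq] with r hr y hy
  have h1 := hr y hy
  have hsplit := measureReal_inter_add_sdiff (μ := μ) (s := Metric.closedBall y r) hS
  rw [inter_comm] at hsplit
  rcases (measureReal_nonneg (μ := μ) (s := Metric.closedBall y r)).eq_or_lt with h0 | h0
  · rw [← h0] at hsplit ⊢
    have := measureReal_nonneg (μ := μ) (s := S ∩ Metric.closedBall y r)
    linarith
  · have hne : μ (Metric.closedBall y r) ≠ 0 := fun h => by simp [measureReal_def, h] at h0
    have h2 := (ENNReal.ofReal_le_iff_le_toReal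
      (ENNReal.div_lt_top (measure_ne_top _ _) hne).ne).1 h1.le
    rw [ENNReal.toReal_div] at h2
    change 1 - η ≤ μ.real _ / μ.real _ at h2
    rw [le_div_iff₀ h0] at h2
    linarith

/-! ### Privalov's theorem in the half plane. -/

/-- If a holomorphic function is small on one side of a square, it is small at the centre. -/
theorem norm_center_pow_four_le {φ : ℂ → ℂ} {c : ℂ} {s κ B : ℝ} (hs : 0 < s) (hκ : 0 ≤ κ)
    (hd : ∀ w : ℂ, |(w - c).re| ≤ s → |(w - c).im| ≤ s → DifferentiableAt ℂ φ w)
    (hB : ∀ w : ℂ, |(w - c).re| ≤ s → |(w - c).im| ≤ s → ‖φ w‖ ≤ B)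
    (hbot : ∀ w : ℂ, |(w - c).re| ≤ s → (w - c).im = -s → ‖φ w‖ ≤ κ) :
    ‖φ c‖ ^ 4 ≤ κ * B ^ 3 := by
  let Q : Set ℂ := Ioo (-s) s ×ℂ Ioo (-s) s
  -- Each side of the square is carried to the bottom by one of the four quarter turns, so on the
  -- whole boundary one factor is at most `κ` and the others at most `B`; at the centre the product
  -- is `φ c ^ 4`.
  let Φ : ℂ → ℂ := fun u => φ (c + u) * φ (c + Complex.I * u) * (φ (c - u) * φ (c - Complex.I * u))
  have hclos : closure Q = Icc (-s) s ×ℂ Icc (-s) s := by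
    rw [Complex.closure_reProdIm, closure_Ioo (by linarith)]
  have hQo : IsOpen Q := isOpen_Ioo.reProdIm isOpen_Ioo
  have hmem : ∀ u ∈ closure Q, |u.re| ≤ s ∧ |u.im| ≤ s := by
    intro u hu
    rw [hclos, Complex.mem_reProdIm] at hu
    exact ⟨abs_le.2 hu.1, abs_le.2 hu.2⟩
  have hB0 : 0 ≤ B := (norm_nonneg _).trans (hB c (by simp [hs.le]) (by simp [hs.le]))
  have hdiff : DifferentiableOn ℂ Φ (closure Q) := by
    intro u hu
    obtain ⟨h1, h2⟩ := hmem u hu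
    have e1 : DifferentiableAt ℂ φ (c + u) := hd _ (by simpa) (by simpa)
    have e2 : DifferentiableAt ℂ φ (c + Complex.I * u) := hd _ (by simpa) (by simpa)
    have e3 : DifferentiableAt ℂ φ (c - u) := hd _ (by simpa) (by simpa)
    have e4 : DifferentiableAt ℂ φ (c - Complex.I * u) := hd _ (by simpa) (by simpa)
    have d1 : DifferentiableAt ℂ (fun u => φ (c + u)) u := e1.comp u (by fun_prop)
    have d2 : DifferentiableAt ℂ (fun u => φ (c + Complex.I * u)) u :=
      e2.comp (f := fun u => c + Complex.I * u) u (by fun_prop)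
    have d3 : DifferentiableAt ℂ (fun u => φ (c - u)) u := e3.comp u (by fun_prop)
    have d4 : DifferentiableAt ℂ (fun u => φ (c - Complex.I * u)) u :=
      e4.comp (f := fun u => c - Complex.I * u) u (by fun_prop)
    exact ((d1.mul d2).mul (d3.mul d4)).differentiableWithinAt
  have hbd : Bornology.IsBounded Q := (Metric.isBounded_Ioo _ _).reProdIm (Metric.isBounded_Ioo _ _)
  have hfr : ∀ u ∈ frontier Q, ‖Φ u‖ ≤ κ * B ^ 3 := by
    intro u hu
    rw [hQo.frontier_eq] at hu
    obtain ⟨h1, h2⟩ := hmem u hu.1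
    have b1 : ‖φ (c + u)‖ ≤ B := hB _ (by simpa) (by simpa)
    have b2 : ‖φ (c + Complex.I * u)‖ ≤ B := hB _ (by simpa) (by simpa)
    have b3 : ‖φ (c - u)‖ ≤ B := hB _ (by simpa) (by simpa)
    have b4 : ‖φ (c - Complex.I * u)‖ ≤ B := hB _ (by simpa) (by simpa)
    have hcases : u.im = -s ∨ u.re = -s ∨ u.im = s ∨ u.re = s := by
      by_contra! hcon
      apply hu.2
      rw [Complex.mem_reProdIm]
      rw [abs_le] at h1 h2
      exact ⟨⟨lt_of_le_of_ne h1.1 (Ne.symm hcon.2.1), lt_of_le_of_ne h1.2 hcon.2.2.2⟩,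
        ⟨lt_of_le_of_ne h2.1 (Ne.symm hcon.1), lt_of_le_of_ne h2.2 hcon.2.2.1⟩⟩
    have hΦ : ‖Φ u‖ = ‖φ (c + u)‖ * ‖φ (c + Complex.I * u)‖ *
        (‖φ (c - u)‖ * ‖φ (c - Complex.I * u)‖) := by simp [Φ]
    rw [hΦ]
    rcases hcases with h | h | h | h
    · have b : ‖φ (c + u)‖ ≤ κ := hbot _ (by simpa) (by simpa)
      calc _ ≤ κ * B * (B * B) := by gcongr
        _ = _ := by ring
    · have b : ‖φ (c + Complex.I * u)‖ ≤ κ := hbot _ (by simpa) (by simpa)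
      calc _ ≤ B * κ * (B * B) := by gcongr
        _ = _ := by ring
    · have b : ‖φ (c - u)‖ ≤ κ := hbot _ (by simpa) (by simpa)
      calc _ ≤ B * B * (κ * B) := by gcongr
        _ = _ := by ring
    · have b : ‖φ (c - Complex.I * u)‖ ≤ κ := hbot _ (by simpa) (by simpa)
      calc _ ≤ B * B * (B * κ) := by gcongr
        _ = _ := by ring
  have h0 : (0 : ℂ) ∈ closure Q := by
    rw [hclos, Complex.mem_reProdIm]; simp [hs.le]
  have := Complex.norm_le_of_forall_mem_frontier_norm_le hbd
    (hdiff.diffContOnCl) hfr h0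
  calc ‖φ c‖ ^ 4 = ‖Φ 0‖ := by simp [Φ]; ring
    _ ≤ _ := this

/-- The truncated cone with vertex `x ∈ ℝ`, aperture `c` and height `v₀` in the upper half plane. -/
def truncatedCone (c v₀ x : ℝ) : Set ℂ := {w | |w.re - x| < c * w.im ∧ w.im < v₀}

theorem convex_truncatedCone {c v₀ x : ℝ} : Convex ℝ (truncatedCone c v₀ x) := by
  intro w hw z hz a b ha hb hab
  simp only [truncatedCone, mem_ofPred_eq, abs_lt, Complex.add_re, Complex.add_im,
    Complex.real_smul, Complex.re_ofReal_mul, Complex.im_ofReal_mul] at hw hz ⊢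
  obtain rfl : b = 1 - a := by linarith
  rcases ha.eq_or_lt with rfl | ha
  · simpa using hz
  have h1 := mul_lt_mul_of_pos_left hw.1.1 ha
  have h2 := mul_lt_mul_of_pos_left hw.1.2 ha
  have h3 := mul_lt_mul_of_pos_left hw.2 ha
  have h4 := mul_le_mul_of_nonneg_left hz.1.1.le hb
  have h5 := mul_le_mul_of_nonneg_left hz.1.2.le hb
  have h6 := mul_le_mul_of_nonneg_left hz.2.le hb
  refine ⟨⟨?_, ?_⟩, ?_⟩ <;> nlinarith

section HalfPlane

variable {H H' : ℂ → ℂ} {K : Set ℝ} {c v₀ M : ℝ}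

theorem im_pos_of_mem_truncatedCone {x : ℝ} {w : ℂ} (hc : 0 < c) (hw : w ∈ truncatedCone c v₀ x) :
    0 < w.im :=
  pos_of_mul_pos_right ((abs_nonneg _).trans_lt hw.1) hc.le

/-- A function on the half plane with bounded derivative on the cones over `K` has Lipschitz-type
boundary values on `K`. -/
theorem exists_boundary_value (hH : ∀ w : ℂ, 0 < w.im → HasDerivAt H (H' w) w)
    (hc : 0 < c) (hv : 0 < v₀) (hM0 : 0 ≤ M)
    (hM : ∀ x ∈ K, ∀ w ∈ truncatedCone c v₀ x, ‖H' w‖ ≤ M) :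
    ∃ b : ℝ → ℂ, ∀ x ∈ K, ∀ w ∈ truncatedCone c v₀ x, ‖H w - b x‖ ≤ M * ‖w - x‖ := by
  have key : ∀ x ∈ K, ∃ b : ℂ, ∀ w ∈ truncatedCone c v₀ x, ‖H w - b‖ ≤ M * ‖w - x‖ := by
    intro x hx
    have hlip : LipschitzOnWith ⟨M, hM0⟩ H (truncatedCone c v₀ x) := by
      apply convex_truncatedCone.lipschitzOnWith_of_nnnorm_hasDerivWithin_le
        (f' := H') (𝕜 := ℂ)
      · intro w hw
        exact (hH w (im_pos_of_mem_truncatedCone hc hw)).hasDerivWithinAt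
      · intro w hw
        exact_mod_cast hM x hx w hw
    have hnb : (𝓝[truncatedCone c v₀ x] (x : ℂ)).NeBot := by
      have ht : Tendsto (fun v : ℝ => (x : ℂ) + v * Complex.I) (𝓝[>] 0)
          (𝓝[truncatedCone c v₀ x] (x : ℂ)) := by
        apply tendsto_nhdsWithin_of_tendsto_nhds_of_eventually_within
        · apply tendsto_nhdsWithin_of_tendsto_nhds
          have : Continuous fun v : ℝ => (x : ℂ) + v * Complex.I := by fun_prop
          simpa using this.tendsto 0
        · filter_upwards [Ioo_mem_nhdsGT hv] with v hv
          simp [truncatedCone, hv.2, mul_pos hc hv.1]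
      exact ht.neBot
    have hcau : Cauchy (map H (𝓝[truncatedCone c v₀ x] (x : ℂ))) :=
      (Cauchy.mono (hg := hnb) cauchy_nhds inf_le_left).map_of_le hlip.uniformContinuousOn inf_le_right
    obtain ⟨b, hb⟩ := cauchy_map_iff_exists_tendsto.1 hcau
    refine ⟨b, fun w hw => ?_⟩
    have t1 : Tendsto (fun z => ‖H w - H z‖) (𝓝[truncatedCone c v₀ x] (x : ℂ)) (𝓝 ‖H w - b‖) :=
      (tendsto_const_nhds.sub hb).norm
    have t2 : Tendsto (fun z => M * ‖w - z‖) (𝓝[truncatedCone c v₀ x] (x : ℂ))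
        (𝓝 (M * ‖w - x‖)) := by
      apply tendsto_nhdsWithin_of_tendsto_nhds
      have : Continuous fun z : ℂ => M * ‖w - z‖ := by fun_prop
      exact this.tendsto _
    refine le_of_tendsto_of_tendsto t1 t2 ?_
    filter_upwards [self_mem_nhdsWithin] with z hz
    have := hlip.dist_le_mul w hw z hz
    rwa [dist_eq_norm, dist_eq_norm] at this
  choose! b hb using key
  exact ⟨b, hb⟩

/-- Both boundary values are compared with `H` at one common point of the two cones, at height `2 *
|x - y| / c` above `x`; the condition on `|x - y|` keeps this height below `v₀`. -/
theorem norm_boundary_value_sub_le {b : ℝ → ℂ} (hc : 0 < c) (hM0 : 0 ≤ M)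
    (hb : ∀ x ∈ K, ∀ w ∈ truncatedCone c v₀ x, ‖H w - b x‖ ≤ M * ‖w - x‖)
    {x y : ℝ} (hx : x ∈ K) (hy : y ∈ K) (hxy : |x - y| < c * v₀ / 2) :
    ‖b x - b y‖ ≤ M * (4 / c + 1) * |x - y| := by
  rcases eq_or_ne x y with rfl | hne
  · simp
  have hpos : 0 < |x - y| := abs_pos.2 (sub_ne_zero.2 hne)
  set v := 2 * |x - y| / c with hvdef
  have hcv : c * v = 2 * |x - y| := by rw [hvdef]; field_simp
  have hv : 0 < v := by positivity
  have hvv : v < v₀ := by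
    rw [hvdef, div_lt_iff₀ hc]; linarith
  set w : ℂ := x + v * Complex.I with hw
  have h1 : w ∈ truncatedCone c v₀ x := by
    refine ⟨?_, ?_⟩ <;> simp [hw, hvv, mul_pos hc hv]
  have h2 : w ∈ truncatedCone c v₀ y := by
    refine ⟨?_, ?_⟩ <;> simp only [hw, Complex.add_re, Complex.ofReal_re, Complex.mul_re,
      Complex.I_re, Complex.I_im, Complex.ofReal_im, Complex.add_im, Complex.mul_im] <;>
      norm_num
    · linarith
    · exact hvv
  have n1 : ‖w - x‖ = v := by simp [hw, abs_of_pos hv]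
  have n2 : ‖w - y‖ ≤ |x - y| + v := by
    have : w - y = ((x - y : ℝ) : ℂ) + v * Complex.I := by rw [hw]; push_cast; ring
    rw [this]
    refine (norm_add_le _ _).trans ?_
    rw [Complex.norm_real, norm_mul, Complex.norm_real, Complex.norm_I, mul_one, Real.norm_eq_abs,
      Real.norm_eq_abs, abs_of_pos hv]
  calc ‖b x - b y‖ = ‖(H w - b y) - (H w - b x)‖ := by congr 1; ring
    _ ≤ ‖H w - b y‖ + ‖H w - b x‖ := norm_sub_le _ _
    _ ≤ M * (|x - y| + v) + M * v := by
        refine add_le_add ((hb y hy w h2).trans (by gcongr)) ((hb x hx w h1).trans (by rw [n1]))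
    _ = M * (4 / c + 1) * |x - y| := by rw [hvdef]; field_simp; ring

/-- The Lipschitz bound only holds at distances below `c * v₀ / 2`, so Rademacher's theorem is
applied on balls of half that radius with rational centres. -/
theorem ae_differentiableWithinAt_boundary_value {b : ℝ → ℂ} (hc : 0 < c) (hv : 0 < v₀)
    (hM0 : 0 ≤ M)
    (hb : ∀ x ∈ K, ∀ w ∈ truncatedCone c v₀ x, ‖H w - b x‖ ≤ M * ‖w - x‖) :
    ∀ᵐ x : ℝ, x ∈ K → DifferentiableWithinAt ℝ b K x := by
  set ρ := c * v₀ / 4 with hρ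
  have hρ0 : 0 < ρ := by positivity
  have h : ∀ q : ℚ, ∀ᵐ x : ℝ, x ∈ K ∩ Metric.ball (q : ℝ) ρ →
      DifferentiableWithinAt ℝ b (K ∩ Metric.ball (q : ℝ) ρ) x := by
    intro q
    have hL : LipschitzOnWith ⟨M * (4 / c + 1), by positivity⟩ b (K ∩ Metric.ball (q : ℝ) ρ) := by
      apply LipschitzOnWith.of_dist_le_mul
      intro x hx y hy
      rw [dist_eq_norm, Real.dist_eq]
      refine norm_boundary_value_sub_le hc hM0 hb hx.1 hy.1 ?_
      have := dist_triangle_right x y (q : ℝ)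
      rw [Real.dist_eq] at this
      have h1 := Metric.mem_ball.1 hx.2
      have h2 := Metric.mem_ball.1 hy.2
      linarith
    exact hL.ae_differentiableWithinAt_of_mem_real
  filter_upwards [ae_all_iff.2 h] with x hx hxK
  obtain ⟨q, hq⟩ := (Rat.denseRange_cast (𝕜 := ℝ)).exists_dist_lt x hρ0
  have := hx q ⟨hxK, hq⟩
  exact (differentiableWithinAt_inter (Metric.isOpen_ball.mem_nhds hq)).1 this

/-- **Privalov's theorem** in the half plane, stated for the derivative `H'` of `H`: if `H'` is
bounded on the truncated cones over `K`, it has vertical limits at almost every point of `K`. -/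
theorem ae_tendsto_vertical_of_bounded_on_cones
    (hH : ∀ w : ℂ, 0 < w.im → HasDerivAt H (H' w) w)
    (hc : 0 < c) (hv : 0 < v₀) (hM0 : 0 ≤ M)
    (hM : ∀ x ∈ K, ∀ w ∈ truncatedCone c v₀ x, ‖H' w‖ ≤ M) :
    ∀ᵐ x : ℝ, x ∈ K →
      ∃ l, Tendsto (fun v : ℝ => H' (x + v * Complex.I)) (𝓝[>] 0) (𝓝 l) := by
  obtain ⟨b, hb⟩ := exists_boundary_value hH hc hv hM0 hM
  filter_upwards [ae_eventually_inter_closedBall_nonempty volume K,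
    ae_differentiableWithinAt_boundary_value hc hv hM0 hb] with p hdens hdiff hp
  specialize hdens hp
  obtain ⟨a, ha⟩ : ∃ a, HasDerivWithinAt b a K p := ⟨_, (hdiff hp).hasDerivWithinAt⟩
  refine ⟨a, ?_⟩
  -- Large enough that `Φ` is at most `N * t` on the squares below and `N * η * t` on their bottom
  -- sides.
  set N := 4 * (M + ‖a‖) + 4 with hN
  have hN0 : 0 < N := by positivity
  set Φ : ℂ → ℂ := fun w => H w - b p - a * (w - p) with hΦ
  have hΦd : ∀ w : ℂ, 0 < w.im → HasDerivAt Φ (H' w - a) w := by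
    intro w hw
    have := ((hH w hw).sub_const (b p)).sub (((hasDerivAt_id w).sub_const (p : ℂ)).const_mul a)
    rw [mul_one] at this
    exact this
  have main : ∀ θ : ℝ, 0 < θ → θ ≤ 1 / 2 → ∀ᶠ t : ℝ in 𝓝[>] (0 : ℝ),
      ‖H' (p + t * Complex.I) - a‖ ≤ 4 * N * θ := by
    intro θ hθ hθ1
    -- The square lemma costs a fourth root.
    set η := θ ^ 4 with hη
    have hη0 : 0 < η := by positivity
    have hη1 : η ≤ 1 / 8 := by
      calc η ≤ (1 / 2) ^ 4 := by rw [hη]; gcongr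
        _ ≤ 1 / 8 := by norm_num
    -- Density supplies a point of `K` within `ρ * t` of `w.re`; the first bound puts every `w` of
    -- height at least `η * t` in the cone over that point, the second controls the distance to it.
    set ρ := min (c * η / 2) η with hρ
    have hρ0 : 0 < ρ := by positivity
    have hρη : ρ ≤ η := min_le_right _ _
    have hρc : ρ ≤ c * η / 2 := min_le_left _ _
    have hscale : Tendsto (fun t : ℝ => ρ * t) (𝓝[>] 0) (𝓝[>] 0) := by
      apply tendsto_nhdsWithin_of_tendsto_nhds_of_eventually_within
      · apply tendsto_nhdsWithin_of_tendsto_nhds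
        have : Continuous fun t : ℝ => ρ * t := by fun_prop
        simpa using this.tendsto 0
      · filter_upwards [self_mem_nhdsWithin] with t ht
        exact mul_pos hρ0 ht
    have hd1 := hscale.eventually (hdens (3 / 2 / ρ))
    have hlin : ∀ᶠ y in 𝓝[K] p, ‖b y - b p - (y - p) • a‖ ≤ η * ‖y - p‖ :=
      (hasDerivWithinAt_iff_isLittleO.1 ha).def hη0
    rw [eventually_nhdsWithin_iff, Metric.eventually_nhds_iff] at hlin
    obtain ⟨δ, hδ, hlin⟩ := hlin
    filter_upwards [hd1, Ioo_mem_nhdsGT (show 0 < min (v₀ / 3) (δ / 2) by positivity)]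
      with t hd1 ht
    obtain ⟨ht0, ht1⟩ := ht
    have ht2 : 3 * t < v₀ := by have := ht1.trans_le (min_le_left _ _); linarith
    have ht3 : 2 * t < δ := by have := ht1.trans_le (min_le_right _ _); linarith
    have est : ∀ w : ℂ, |w.re - p| ≤ 3 / 2 * t → η * t ≤ w.im → w.im ≤ 11 / 4 * t →
        ‖Φ w‖ ≤ (M + ‖a‖) * (w.im + η * t) + 2 * η * t := by
      intro w hw1 hw2 hw3
      obtain ⟨y, hyK, hyB⟩ := hd1 w.re (by
        rw [Real.dist_eq, abs_sub_comm]
        calc _ ≤ _ := hw1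
          _ = _ := by field_simp)
      rw [Metric.mem_closedBall, Real.dist_eq, abs_sub_comm] at hyB
      have hηt : 0 < η * t := by positivity
      have hcone : w ∈ truncatedCone c v₀ y := by
        refine ⟨?_, by linarith⟩
        have e1 : ρ * t ≤ c * η / 2 * t := by gcongr
        have e2 : c * (η * t) ≤ c * w.im := by gcongr
        have e3 : 0 < c * (η * t) := by positivity
        nlinarith
      have hwy : ‖w - y‖ ≤ w.im + η * t := by
        have : ‖w - y‖ ≤ |(w - y).re| + |(w - y).im| := Complex.norm_le_abs_re_add_abs_im _
        simp only [Complex.sub_re, Complex.ofReal_re, Complex.sub_im, Complex.ofReal_im,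
          sub_zero] at this
        rw [abs_of_pos (hηt.trans_le hw2)] at this
        have : ρ * t ≤ η * t := by gcongr
        linarith
      have hyp : |y - p| ≤ 2 * t := by
        have h1 : |y - p| ≤ |w.re - y| + |w.re - p| := by
          rw [abs_sub_comm w.re y]
          exact abs_sub_le _ _ _
        have : ρ * t ≤ 1 / 8 * t := by gcongr; linarith
        linarith
      have h1 := hb y hyK w hcone
      have h2 := hlin (show dist y p < δ by rw [Real.dist_eq]; linarith) hyK
      have hsplit : Φ w = (H w - b y) + (b y - b p - (y - p) • a) - a * (w - y) := by
        simp only [hΦ, Complex.real_smul]; push_cast; ring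
      rw [hsplit]
      calc _ ≤ ‖H w - b y‖ + ‖b y - b p - (y - p) • a‖ + ‖a * (w - y)‖ :=
            (norm_sub_le _ _).trans (by gcongr; exact norm_add_le _ _)
        _ ≤ M * (w.im + η * t) + η * (2 * t) + ‖a‖ * (w.im + η * t) := by
            rw [norm_mul]
            gcongr
            · exact h1.trans (by gcongr)
            · exact h2.trans (by rw [Real.norm_eq_abs]; gcongr)
        _ = _ := by ring
    have hq : ∀ q : ℂ, ‖q - (p + t * Complex.I)‖ ≤ t / 4 → ‖Φ q‖ ≤ N * θ * t := by
      intro q hq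
      have hηt : η * t ≤ 1 / 8 * t := by gcongr
      have hηt0 : 0 < η * t := by positivity
      have hre := (Complex.abs_re_le_norm _).trans hq
      have him := (Complex.abs_im_le_norm _).trans hq
      simp only [Complex.sub_re, Complex.add_re, Complex.ofReal_re, Complex.mul_re, Complex.I_re,
        Complex.I_im, Complex.ofReal_im, Complex.sub_im, Complex.add_im, Complex.mul_im] at hre him
      norm_num at hre him
      rw [abs_le] at hre him
      -- The square about `q` then has its bottom side at height `η * t`, the lowest height at which
      -- `est` applies.
      set s := q.im - η * t with hs
      have hs0 : 0 < s := by linarith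
      have hcoord : ∀ w : ℂ, |(w - q).re| ≤ s → |(w - q).im| ≤ s →
          |w.re - p| ≤ 3 / 2 * t ∧ η * t ≤ w.im ∧ w.im ≤ 11 / 4 * t := by
        intro w h1 h2
        simp only [Complex.sub_re, Complex.sub_im, abs_le] at h1 h2
        refine ⟨abs_le.2 ⟨?_, ?_⟩, ?_, ?_⟩ <;> linarith
      have h4 : ‖Φ q‖ ^ 4 ≤ (N * η * t) * (N * t) ^ 3 := by
        refine norm_center_pow_four_le hs0 (by positivity) ?_ ?_ ?_
        · intro w h1 h2
          exact (hΦd w (by linarith [(hcoord w h1 h2).2.1])).differentiableAt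
        · intro w h1 h2
          obtain ⟨c1, c2, c3⟩ := hcoord w h1 h2
          calc _ ≤ _ := est w c1 c2 c3
            _ ≤ (M + ‖a‖) * (11 / 4 * t + 1 / 8 * t) + 2 * (1 / 8 * t) := by
              rw [mul_assoc 2 η t]; gcongr
            _ ≤ N * t := by rw [hN]; nlinarith [mul_nonneg (add_nonneg hM0 (norm_nonneg a)) ht0.le]
        · intro w h1 h2
          have h2' : |(w - q).im| ≤ s := by rw [h2, abs_neg, abs_of_pos hs0]
          obtain ⟨c1, c2, c3⟩ := hcoord w h1 h2'
          have h5 : w.im = η * t := by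
            simp only [Complex.sub_im] at h2; linarith
          calc _ ≤ _ := est w c1 c2 c3
            _ ≤ N * η * t := by
              rw [h5, hN]; nlinarith [mul_nonneg (add_nonneg hM0 (norm_nonneg a)) hηt0.le]
      have h6 : ‖Φ q‖ ^ 4 ≤ (N * θ * t) ^ 4 := by
        calc _ ≤ _ := h4
          _ = _ := by rw [hη]; ring
      exact le_of_pow_le_pow_left₀ (by norm_num) (by positivity) h6
    have hder : deriv Φ (p + t * Complex.I) = H' (p + t * Complex.I) - a :=
      (hΦd _ (by simpa using ht0)).deriv
    rw [← hder]
    -- Cauchy's estimate on the circle of radius `t / 4`: the factor `t` cancels.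
    have hcauchy : ‖deriv Φ (p + t * Complex.I)‖ ≤ N * θ * t / (t / 4) := by
      apply Complex.norm_deriv_le_of_forall_mem_sphere_norm_le (by positivity)
      · apply DifferentiableOn.diffContOnCl
        intro w hw
        have hw' := Metric.closure_ball_subset_closedBall hw
        rw [Metric.mem_closedBall, dist_eq_norm] at hw'
        have him := (Complex.abs_im_le_norm _).trans hw'
        simp only [Complex.sub_im, Complex.add_im, Complex.ofReal_im, Complex.mul_im,
          Complex.ofReal_re, Complex.I_im, Complex.I_re] at him
        norm_num at him
        rw [abs_le] at him
        exact (hΦd w (by linarith)).differentiableAt.differentiableWithinAt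
      · intro w hw
        rw [mem_sphere_iff_norm] at hw
        exact hq w hw.le
    refine hcauchy.trans (le_of_eq ?_)
    field_simp
  rw [Metric.tendsto_nhds]
  intro ε hε
  set θ := min (1 / 2) (ε / (8 * N)) with hθ
  have hθ0 : 0 < θ := by positivity
  filter_upwards [main θ hθ0 (min_le_left _ _)] with t ht
  rw [dist_eq_norm]
  calc _ ≤ _ := ht
    _ ≤ 4 * N * (ε / (8 * N)) := by gcongr; exact min_le_right _ _
    _ < ε := by field_simp; linarith

end HalfPlane

/-! ### Privalov's theorem in the disc. -/

/-- Stolz regions contain the images of truncated cones under `w ↦ exp (i w)`. -/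
theorem norm_one_sub_exp_lt {α : ℝ} (hα : 1 < α) : ∃ c v₀ : ℝ, 0 < c ∧ 0 < v₀ ∧
    ∀ w : ℂ, |w.re| < c * w.im → w.im < v₀ →
      ‖1 - Complex.exp (Complex.I * w)‖ < α * (1 - Real.exp (-w.im)) := by
  have hc : 0 < min ((α - 1) / 2) 1 := lt_min (by linarith) one_pos
  -- To first order the claim reads `(1 + c) * v < α * v`, leaving a margin of `(α - 1) / 2 * v`;
  -- the height bound lets this absorb the quadratic errors `4 * v ^ 2` and `α * v ^ 2`.
  refine ⟨min ((α - 1) / 2) 1, (α - 1) / (2 * (4 + α)), hc, by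
    apply div_pos <;> linarith, ?_⟩
  intro w hw hwv
  set c := min ((α - 1) / 2) 1
  have hc1 : c ≤ 1 := min_le_right _ _
  have hc2 : c ≤ (α - 1) / 2 := min_le_left _ _
  set v := w.im
  have hv : 0 < v := pos_of_mul_pos_right ((abs_nonneg _).trans_lt hw) hc.le
  have hvv : (4 + α) * v < (α - 1) / 2 := by
    rw [lt_div_iff₀ (by linarith)] at hwv; linarith
  have hv1 : v < 1 / 2 := by nlinarith
  have hn : ‖Complex.I * w‖ ≤ (1 + c) * v := by
    rw [norm_mul, Complex.norm_I, one_mul]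
    have := Complex.norm_le_abs_re_add_abs_im w
    rw [abs_of_pos (show 0 < w.im from hv)] at this
    change _ ≤ |w.re| + v at this
    linarith
  have hn1 : ‖Complex.I * w‖ ≤ 1 := hn.trans (by nlinarith)
  have h1 := Complex.norm_exp_sub_one_sub_id_le hn1
  have h2 : ‖1 - Complex.exp (Complex.I * w)‖ ≤ ‖Complex.I * w‖ + ‖Complex.I * w‖ ^ 2 := by
    rw [norm_sub_rev]
    calc _ = ‖(Complex.exp (Complex.I * w) - 1 - Complex.I * w) + Complex.I * w‖ := by
          congr 1; ring
      _ ≤ _ := (norm_add_le _ _).trans (by linarith)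
  have h3 := Real.abs_exp_sub_one_sub_id_le (x := -v) (by rw [abs_neg, abs_of_pos hv]; linarith)
  rw [abs_le] at h3
  have h4 : ‖Complex.I * w‖ ^ 2 ≤ (2 * v) ^ 2 := by
    gcongr; exact hn.trans (by nlinarith)
  nlinarith [mul_lt_mul_of_pos_right hvv hv]

/-- **Privalov's theorem** in the unit disc: a holomorphic function which is bounded on the Stolz
regions of aperture `α` at the points `exp (iθ)`, `θ ∈ K`, has radial limits at almost every such
point. -/
theorem ae_tendsto_radial_of_bounded_on_stolz {g : ℂ → ℂ}
    (hg : DifferentiableOn ℂ g (Metric.ball 0 1)) {α M : ℝ} (hα : 1 < α) {K : Set ℝ}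
    (hK : ∀ θ ∈ K, ∀ z ∈ Metric.ball (0 : ℂ) 1,
      ‖1 - Complex.exp (-(Complex.I * θ)) * z‖ < α * (1 - ‖z‖) → ‖g z‖ ≤ M) :
    ∀ᵐ θ : ℝ, θ ∈ K →
      ∃ l, Tendsto (fun r : ℝ => g (r * Complex.exp (Complex.I * θ))) (𝓝[<] 1) (𝓝 l) := by
  -- With a primitive `G` of `g`, the function `g` becomes, up to the nonvanishing factor `i * exp
  -- (i w)`, the derivative of `G (exp (i w))`.
  obtain ⟨G, hG⟩ := hg.isExactOn_ball
  obtain ⟨c, v₀, hc, hv, hcone⟩ := norm_one_sub_exp_lt hα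
  have hnorm : ∀ w : ℂ, ‖Complex.exp (Complex.I * w)‖ = Real.exp (-w.im) := by
    intro w; simp [Complex.norm_exp]
  have hH : ∀ w : ℂ, 0 < w.im → HasDerivAt (fun w => G (Complex.exp (Complex.I * w)))
      (g (Complex.exp (Complex.I * w)) * (Complex.exp (Complex.I * w) * Complex.I)) w := by
    intro w hw
    have h1 := hG (Complex.exp (Complex.I * w)) (by
      rw [mem_ball_zero_iff, hnorm]; simpa using hw)
    have h2 : HasDerivAt (fun w : ℂ => Complex.exp (Complex.I * w))
        (Complex.exp (Complex.I * w) * Complex.I) w := by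
      simpa using ((hasDerivAt_id w).const_mul Complex.I).cexp
    exact h1.comp w h2
  have hM : ∀ x ∈ K, ∀ w ∈ truncatedCone c v₀ x,
      ‖g (Complex.exp (Complex.I * w)) * (Complex.exp (Complex.I * w) * Complex.I)‖ ≤ max M 0 := by
    intro x hx w hw
    have him := im_pos_of_mem_truncatedCone hc hw
    have h1 : Real.exp (-w.im) ≤ 1 := by simpa using him.le
    have h2 : ‖g (Complex.exp (Complex.I * w))‖ ≤ M := by
      apply hK x hx
      · rw [mem_ball_zero_iff, hnorm]; simpa using him
      · have := hcone (w - x) (by simpa using hw.1) (by simpa using hw.2)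
        rw [hnorm, ← Complex.exp_add]
        convert this using 3
        · congr 1; ring
        · simp
    rw [norm_mul, norm_mul, Complex.norm_I, mul_one, hnorm]
    calc _ ≤ max M 0 * 1 := by gcongr; exact h2.trans (le_max_left _ _)
      _ = _ := mul_one _
  filter_upwards [ae_tendsto_vertical_of_bounded_on_cones hH hc hv (le_max_right _ _) hM]
    with θ hθ hθK
  obtain ⟨l, hl⟩ := hθ hθK
  have hlog : Tendsto (fun r : ℝ => -Real.log r) (𝓝[<] 1) (𝓝[>] 0) := by
    apply tendsto_nhdsWithin_of_tendsto_nhds_of_eventually_within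
    · apply tendsto_nhdsWithin_of_tendsto_nhds
      have := (Real.continuousAt_log one_ne_zero).neg.tendsto
      rwa [Pi.neg_apply, Real.log_one, neg_zero] at this
    · filter_upwards [Ioo_mem_nhdsLT one_pos] with r hr
      simpa using Real.log_neg hr.1 hr.2
  have hl2 := hl.comp hlog
  have hd : Tendsto (fun r : ℝ => (r : ℂ) * Complex.exp (Complex.I * θ) * Complex.I) (𝓝[<] 1)
      (𝓝 ((1 : ℝ) * Complex.exp (Complex.I * θ) * Complex.I)) := by
    apply tendsto_nhdsWithin_of_tendsto_nhds
    have : Continuous fun r : ℝ => (r : ℂ) * Complex.exp (Complex.I * θ) * Complex.I := by fun_prop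
    exact this.tendsto 1
  refine ⟨_, (hl2.div hd (by simp [Complex.exp_ne_zero])).congr' ?_⟩
  filter_upwards [Ioo_mem_nhdsLT one_pos] with r hr
  have he : Complex.exp (Complex.I * (θ + ((-Real.log r : ℝ) : ℂ) * Complex.I)) =
      r * Complex.exp (Complex.I * θ) := by
    rw [mul_add, Complex.exp_add, mul_comm, mul_comm Complex.I (_ * _), mul_assoc, Complex.I_mul_I,
      mul_neg_one, ← Complex.ofReal_neg, neg_neg, ← Complex.ofReal_exp, Real.exp_log hr.1]
  simp only [Function.comp, Pi.div_apply, he]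
  have h1 : (r : ℂ) ≠ 0 := by exact_mod_cast hr.1.ne'
  have h2 := Complex.exp_ne_zero (Complex.I * θ)
  field_simp

/-! ### From null cones to Hausdorff-null subsets of the sphere. -/

open scoped Pointwise in
/-- A subset of the unit sphere spanning a null cone is null for the Hausdorff measure of
codimension one. -/
theorem hausdorffMeasure_eq_zero_of_cone_null {V : Type*} [NormedAddCommGroup V] [NormedSpace ℝ V]
    [FiniteDimensional ℝ V] [MeasurableSpace V] [BorelSpace V] (μ : Measure V)
    [μ.IsAddHaarMeasure] {m : ℕ} (hm : Module.finrank ℝ V = m + 1) {N : Set V}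
    (hN : N ⊆ Metric.sphere 0 1) (h : μ (Ioo (0 : ℝ) 1 • N) = 0) : μH[(m : ℝ)] N = 0 := by
  let ϕ : V ≃L[ℝ] (Fin (m + 1) → ℝ) := ContinuousLinearEquiv.ofFinrankEq (by simp [hm])
  let Z : Set (Fin (m + 1) → ℝ) := ϕ.symm ⁻¹' (Ioo (0 : ℝ) 1 • N)
  have hZ : volume Z = 0 := by
    have h1 : (μ.map ϕ) Z = 0 := by
      have : MeasurableEmbedding ϕ := ϕ.toHomeomorph.measurableEmbedding
      rw [this.map_apply, ← h]
      congr 1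
      ext x; simp [Z]
    have : (μ.map ϕ).IsAddHaarMeasure := ϕ.isAddHaarMeasure_map μ
    exact Measure.absolutelyContinuous_isAddHaarMeasure volume (μ.map ϕ) h1
  let x : Fin (m + 1) → ℝ → (Fin m → ℝ) → V := fun i s y => ϕ.symm (i.insertNth s y)
  have hxsmul : ∀ i s y (t : ℝ), x i (t * s) (t • y) = t • x i s y := by
    intro i s y t
    simp only [x]
    rw [← map_smul]
    congr 1
    ext j
    refine Fin.succAboveCases i ?_ (fun j => ?_) j <;> simp
  -- By Fubini, almost every coordinate hyperplane section of the null cone is null.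
  have hslice : ∀ i : Fin (m + 1), ∀ᵐ t : ℝ, volume {y : Fin m → ℝ | x i t y ∈ Ioo (0 : ℝ) 1 • N} = 0 := by
    intro i
    have e := (volume_preserving_piFinSuccAbove (fun _ : Fin (m + 1) => ℝ) i).symm
    have h1 := e.quasiMeasurePreserving.preimage_null hZ
    have h2 := Measure.measure_ae_null_of_prod_null h1
    filter_upwards [h2] with t ht
    exact ht
  let A : Fin (m + 1) → ℝ → Set (Fin m → ℝ) := fun i s => {y | ‖x i s y‖⁻¹ • x i s y ∈ N}
  -- A prescribed slice need not be among the good ones. Its part of norm below `k + 1` is shrunk,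
  -- by a factor below `1 / (k + 1)`, into the truncated cone on a slice that is good.
  have hA : ∀ i, ∀ s : ℝ, s ≠ 0 → volume (A i s) = 0 := by
    intro i s hs
    have hcov : A i s ⊆ ⋃ k : ℕ, {y ∈ A i s | ‖x i s y‖ < k + 1} := by
      intro y hy
      obtain ⟨k, hk⟩ := exists_nat_gt ‖x i s y‖
      exact mem_iUnion.2 ⟨k, hy, by linarith⟩
    refine measure_mono_null hcov (measure_iUnion_null fun k => ?_)
    have hopen : IsOpen {t : ℝ | t / s ∈ Ioo (0 : ℝ) (1 / (k + 1))} :=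
      isOpen_Ioo.preimage (by fun_prop)
    obtain ⟨t', ht', hnull⟩ := (Measure.dense_of_ae (hslice i)).exists_mem_open hopen
      ⟨s * (1 / (k + 1) / 2), by
        have : (0 : ℝ) < 1 / (k + 1) := by positivity
        rw [mem_ofPred_eq, mul_div_cancel_left₀ _ hs]; constructor <;> linarith⟩
    obtain ⟨ht0, ht1⟩ := hnull
    set t := t' / s
    have htt : t' = t * s := by simp [t, hs]
    have hsub : {y ∈ A i s | ‖x i s y‖ < k + 1} ⊆
        (fun y => t • y) ⁻¹' {y : Fin m → ℝ | x i t' y ∈ Ioo (0 : ℝ) 1 • N} := by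
      rintro y ⟨hy, hy2⟩
      have hne : 0 < ‖x i s y‖ := by
        have : ‖‖x i s y‖⁻¹ • x i s y‖ = 1 := by simpa using hN hy
        rcases (norm_nonneg (x i s y)).eq_or_lt with h0 | h0
        · rw [← h0] at this; simp at this
        · exact h0
      change x i t' (t • y) ∈ Ioo (0 : ℝ) 1 • N
      rw [htt, hxsmul]
      refine Set.mem_smul.2 ⟨t * ‖x i s y‖, ⟨by positivity, ?_⟩, _, hy, ?_⟩
      · calc t * ‖x i s y‖ < 1 / (k + 1) * (k + 1) := by gcongr
          _ = 1 := by field_simp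
      · rw [smul_smul, mul_assoc, mul_inv_cancel₀ hne.ne', mul_one]
    refine measure_mono_null hsub ?_
    rw [Measure.addHaar_preimage_smul _ ht0.ne', ht', mul_zero]
  -- The hyperplane with coordinate `s = ±1` stays away from the origin, so radial projection from
  -- it is Lipschitz.
  have hlip : ∀ i, ∀ s : ℝ, |s| = 1 → ∃ C, LipschitzWith C (fun y => ‖x i s y‖⁻¹ • x i s y) := by
    intro i s hs
    set a := ‖(ϕ : V →L[ℝ] (Fin (m + 1) → ℝ))‖
    set b := ‖(ϕ.symm : (Fin (m + 1) → ℝ) →L[ℝ] V)‖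
    have hlow : ∀ y, 1 ≤ a * ‖x i s y‖ := by
      intro y
      have h1 := (ϕ : V →L[ℝ] (Fin (m + 1) → ℝ)).le_opNorm (x i s y)
      have h2 := norm_le_pi_norm (ϕ (x i s y)) i
      simp only [x, ContinuousLinearEquiv.apply_symm_apply, Fin.insertNth_apply_same,
        Real.norm_eq_abs, hs] at h2
      simp only [x, ContinuousLinearEquiv.coe_coe, ContinuousLinearEquiv.apply_symm_apply] at h1
      exact h2.trans h1
    have hdiff : ∀ y z, ‖x i s y - x i s z‖ ≤ b * ‖y - z‖ := by
      intro y z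
      simp only [x]
      rw [← map_sub]
      refine ((ϕ.symm : (Fin (m + 1) → ℝ) →L[ℝ] V).le_opNorm _).trans ?_
      gcongr
      rw [pi_norm_le_iff_of_nonneg (norm_nonneg _)]
      intro j
      refine Fin.succAboveCases i ?_ (fun j => ?_) j
      · simp
      · simpa using norm_le_pi_norm (y - z) j
    have hb : 0 ≤ b := norm_nonneg _
    have ha : 0 ≤ a := norm_nonneg _
    refine ⟨(2 * a * b).toNNReal, LipschitzWith.of_dist_le_mul fun y z => ?_⟩
    rw [dist_eq_norm, dist_eq_norm, Real.coe_toNNReal _ (by positivity)]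
    set u := x i s y
    set v := x i s z
    have hu : 0 < ‖u‖ := by
      by_contra! hcon
      have := hlow y
      nlinarith [norm_nonneg u]
    have hv : 0 < ‖v‖ := by
      by_contra! hcon
      have := hlow z
      nlinarith [norm_nonneg v]
    have hinv : ‖u‖⁻¹ ≤ a := by
      rw [inv_le_iff_one_le_mul₀ hu]; exact hlow y
    have heq : ‖u‖⁻¹ • u - ‖v‖⁻¹ • v = ‖u‖⁻¹ • ((u - v) + ((‖v‖ - ‖u‖) * ‖v‖⁻¹) • v) := by
      rw [smul_add, smul_sub, smul_smul, sub_mul, mul_inv_cancel₀ hv.ne', mul_sub, sub_smul,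
        mul_one, ← mul_assoc, inv_mul_cancel₀ hu.ne', one_mul]
      abel
    rw [heq, norm_smul, norm_inv, norm_norm]
    have h3 : ‖((‖v‖ - ‖u‖) * ‖v‖⁻¹) • v‖ ≤ ‖u - v‖ := by
      rw [norm_smul, norm_mul, norm_inv, norm_norm, mul_assoc, inv_mul_cancel₀ hv.ne', mul_one,
        norm_sub_rev u v]
      exact abs_norm_sub_norm_le v u
    calc ‖u‖⁻¹ * ‖(u - v) + ((‖v‖ - ‖u‖) * ‖v‖⁻¹) • v‖ ≤ a * (‖u - v‖ + ‖u - v‖) := by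
          gcongr; exact (norm_add_le _ _).trans (by gcongr)
      _ ≤ a * (b * ‖y - z‖ + b * ‖y - z‖) := by gcongr <;> exact hdiff y z
      _ = _ := by ring
  have himg : ∀ i, ∀ s : ℝ, |s| = 1 → μH[(m : ℝ)] ((fun y => ‖x i s y‖⁻¹ • x i s y) '' A i s) = 0 := by
    intro i s hs
    obtain ⟨C, hC⟩ := hlip i s hs
    have h1 := hC.hausdorffMeasure_image_le (d := (m : ℝ)) (by positivity) (A i s)
    have h2 : μH[(m : ℝ)] (A i s) = 0 := by
      have h3 := hA i s (by rintro rfl; simp at hs)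
      have h4 := hausdorffMeasure_pi_real (ι := Fin m)
      rw [Fintype.card_fin] at h4
      rwa [h4]
    rw [h2, mul_zero] at h1
    exact le_antisymm h1 (zero_le)
  have hcover : N ⊆ ⋃ i : Fin (m + 1), ((fun y => ‖x i 1 y‖⁻¹ • x i 1 y) '' A i 1) ∪
      ((fun y => ‖x i (-1) y‖⁻¹ • x i (-1) y) '' A i (-1)) := by
    intro w hw
    have hw1 : ‖w‖ = 1 := by simpa using hN hw
    have hw0 : ϕ w ≠ 0 := by
      rw [ne_eq, map_eq_zero_iff ϕ ϕ.injective]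
      rintro rfl; simp at hw1
    obtain ⟨i, hi⟩ := Function.ne_iff.1 hw0
    have hi' : ϕ w i ≠ 0 := hi
    have key : ∀ s : ℝ, s = ϕ w i / |ϕ w i| →
        ∃ y ∈ A i s, ‖x i s y‖⁻¹ • x i s y = w := by
      intro s hs
      have habs : 0 < |ϕ w i| := abs_pos.2 hi'
      have hx : x i s (|ϕ w i|⁻¹ • (i.removeNth (ϕ w))) = |ϕ w i|⁻¹ • w := by
        have : s = |ϕ w i|⁻¹ * ϕ w i := by rw [hs]; ring
        rw [this, hxsmul]
        simp [x]
      have hnorm : ‖|ϕ w i|⁻¹ • w‖⁻¹ • |ϕ w i|⁻¹ • w = w := by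
        rw [norm_smul, hw1, mul_one, norm_inv, Real.norm_eq_abs, abs_abs, inv_inv, smul_smul,
          mul_inv_cancel₀ habs.ne', one_smul]
      refine ⟨_, ?_, by rw [hx, hnorm]⟩
      change _ ∈ N
      rw [hx, hnorm]; exact hw
    rcases lt_or_gt_of_ne hi' with hneg | hpos
    · obtain ⟨y, hy, hyw⟩ := key (-1) (by rw [abs_of_neg hneg, div_neg, div_self hi'])
      exact mem_iUnion.2 ⟨i, Or.inr ⟨y, hy, hyw⟩⟩
    · obtain ⟨y, hy, hyw⟩ := key 1 (by rw [abs_of_pos hpos, div_self hi'])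
      exact mem_iUnion.2 ⟨i, Or.inl ⟨y, hy, hyw⟩⟩
  refine measure_mono_null hcover (measure_iUnion_null fun i => measure_union_null ?_ ?_)
  · exact himg i 1 (by simp)
  · exact himg i (-1) (by simp)

/-! ### The Korányi metric on the sphere and its surface measure. -/

section KoranyiDistance

variable {V : Type*} [NormedAddCommGroup V] [InnerProductSpace ℂ V]

theorem norm_sq_eq_add_orthogonal {ζ : V} (hζ : ‖ζ‖ = 1) (x : V) :
    ‖x‖ ^ 2 = ‖inner ℂ ζ x‖ ^ 2 + ‖x - inner ℂ ζ x • ζ‖ ^ 2 := by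
  have h0 : inner ℂ (inner ℂ ζ x • ζ) (x - inner ℂ ζ x • ζ) = 0 := by
    rw [inner_smul_left, inner_sub_right, inner_smul_right, inner_self_eq_norm_sq_to_K, hζ]
    simp
  have h := norm_add_sq_eq_norm_sq_add_norm_sq_of_inner_eq_zero _ _ h0
  rw [add_sub_cancel, norm_smul, hζ, mul_one] at h
  rw [pow_two, pow_two, pow_two, h]

/-- By Pythagoras the left side is at most `1 - |⟨ζ, x⟩|² ≤ 2 (1 - |⟨ζ, x⟩|)`. This is why a
deviation `h` along `ζ` allows one of order `√h` orthogonally. -/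
theorem norm_orthogonal_sq_le {ζ x : V} (hζ : ‖ζ‖ = 1) (hx : ‖x‖ ≤ 1) :
    ‖x - inner ℂ ζ x • ζ‖ ^ 2 ≤ 2 * ‖1 - inner ℂ ζ x‖ := by
  have h := norm_sq_eq_add_orthogonal hζ x
  have h1 : ‖x‖ ^ 2 ≤ 1 := by nlinarith [norm_nonneg x]
  have h2 : 1 ≤ ‖1 - inner ℂ ζ x‖ + ‖inner ℂ ζ x‖ := by
    simpa using norm_add_le (1 - inner ℂ ζ x) (inner ℂ ζ x)
  have h3 : ‖inner ℂ ζ x‖ ≤ 1 := (norm_inner_le_norm _ _).trans (by rw [hζ]; linarith)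
  nlinarith [norm_nonneg (inner ℂ ζ x)]

/-- The triangle inequality for the Korányi distance on the closed unit ball, the middle point
being on the sphere. -/
theorem sqrt_norm_one_sub_inner_le {a b c : V} (ha : ‖a‖ ≤ 1) (hb : ‖b‖ = 1) (hc : ‖c‖ ≤ 1) :
    √‖1 - inner ℂ a c‖ ≤ √‖1 - inner ℂ a b‖ + √‖1 - inner ℂ b c‖ := by
  have hA := norm_orthogonal_sq_le hb ha
  have hC := norm_orthogonal_sq_le hb hc
  have hsymm : ‖1 - inner ℂ b a‖ = ‖1 - inner ℂ a b‖ := by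
    rw [← inner_conj_symm b a, ← RCLike.norm_conj]; simp
  rw [hsymm] at hA
  set A := ‖1 - inner ℂ a b‖
  set C := ‖1 - inner ℂ b c‖
  -- Splitting `a` and `c` along `b` leaves a cross term of the orthogonal parts, at most `2 * √A *
  -- √C`, which completes the square of `√A + √C`.
  have hid : 1 - inner ℂ a c = (1 - inner ℂ a b) + inner ℂ a b * (1 - inner ℂ b c) -
      inner ℂ (a - inner ℂ b a • b) (c - inner ℂ b c • b) := by
    simp only [inner_sub_left, inner_sub_right, inner_smul_left, inner_smul_right,
      inner_self_eq_norm_sq_to_K, hb, inner_conj_symm]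
    simp
    ring
  have hab : ‖inner ℂ a b‖ ≤ 1 := (norm_inner_le_norm _ _).trans (by rw [hb]; linarith)
  have h1 : ‖a - inner ℂ b a • b‖ ≤ √2 * √A := by
    rw [← Real.sqrt_mul (by norm_num)]; exact Real.le_sqrt_of_sq_le hA
  have h2 : ‖c - inner ℂ b c • b‖ ≤ √2 * √C := by
    rw [← Real.sqrt_mul (by norm_num)]; exact Real.le_sqrt_of_sq_le hC
  have h3 : ‖1 - inner ℂ a c‖ ≤ A + 1 * C + (√2 * √A) * (√2 * √C) := by
    rw [hid]
    refine (norm_sub_le _ _).trans (add_le_add ((norm_add_le _ _).trans ?_) ?_)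
    · rw [norm_mul]; gcongr
    · exact (norm_inner_le_norm _ _).trans (by gcongr)
  have hA0 : √A ^ 2 = A := Real.sq_sqrt (norm_nonneg _)
  have hC0 : √C ^ 2 = C := Real.sq_sqrt (norm_nonneg _)
  have h20 : √(2 : ℝ) ^ 2 = 2 := Real.sq_sqrt (by norm_num)
  apply Real.sqrt_le_iff.2 ⟨by positivity, ?_⟩
  calc _ ≤ _ := h3
    _ = √A ^ 2 + √C ^ 2 + √2 ^ 2 * √A * √C := by rw [hA0, hC0]; ring
    _ = _ := by rw [h20]; ring

variable (V) in
/-- The unit sphere of a complex inner product space, with the Korányi distance. -/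
def KoranyiSphere : Type _ := Metric.sphere (0 : V) 1

namespace KoranyiSphere

/-- The inclusion into the ambient space. -/
def val (P : KoranyiSphere V) : V := Subtype.val P

theorem norm_val (P : KoranyiSphere V) : ‖P.val‖ = 1 := by
  exact mem_sphere_zero_iff_norm.1 (Subtype.property P)

/-- The direction of a nonzero vector. -/
noncomputable def direction (w : V) (hw : w ≠ 0) : KoranyiSphere V :=
  ⟨‖w‖⁻¹ • w, by
    rw [mem_sphere_zero_iff_norm, norm_smul, norm_inv, norm_norm,
      inv_mul_cancel₀ (norm_pos_iff.2 hw).ne']⟩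

theorem val_direction (w : V) (hw : w ≠ 0) : (direction w hw).val = ‖w‖⁻¹ • w := rfl

instance : TopologicalSpace (KoranyiSphere V) :=
  inferInstanceAs (TopologicalSpace (Metric.sphere (0 : V) 1))

theorem inner_self (P : KoranyiSphere V) : inner ℂ P.val P.val = 1 := by
  rw [inner_self_eq_norm_sq_to_K, P.norm_val]; simp

theorem isOpen_iff_norm (s : Set (KoranyiSphere V)) : IsOpen s ↔
    ∀ x ∈ s, ∃ ε > 0, ∀ y : KoranyiSphere V, ‖y.val - x.val‖ < ε → y ∈ s := by
  have h : ∀ x y : KoranyiSphere V,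
      ‖y.val - x.val‖ = dist (α := Metric.sphere (0 : V) 1) y x := fun x y =>
    (dist_eq_norm _ _).symm
  simp only [h]
  exact Metric.isOpen_iff (α := Metric.sphere (0 : V) 1)

/-- The two distances are comparable up to powers: `‖x - y‖² ≤ 2 |1 - ⟨x, y⟩|` and `|1 - ⟨x, y⟩| ≤
‖x - y‖`. -/
theorem isOpen_iff_koranyi (s : Set (KoranyiSphere V)) : IsOpen s ↔
    ∀ x ∈ s, ∃ ε > 0, ∀ y : KoranyiSphere V, √‖1 - inner ℂ x.val y.val‖ < ε → y ∈ s := by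
  rw [isOpen_iff_norm]
  refine forall₂_congr fun x hx => ⟨?_, ?_⟩
  · rintro ⟨ε, hε, h⟩
    refine ⟨ε / 2, by positivity, fun y hy => h y ?_⟩
    have h1 : ‖y.val - x.val‖ ^ 2 ≤ 2 * ‖1 - inner ℂ x.val y.val‖ := by
      rw [norm_sub_rev, norm_sub_sq (𝕜 := ℂ), x.norm_val, y.norm_val]
      have := Complex.re_le_norm (1 - inner ℂ x.val y.val)
      simp only [Complex.sub_re, Complex.one_re] at this
      simp only [RCLike.re_to_complex]
      linarith
    rw [Real.sqrt_lt' (by positivity)] at hy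
    apply lt_of_pow_lt_pow_left₀ 2 hε.le
    nlinarith
  · rintro ⟨ε, hε, h⟩
    refine ⟨ε ^ 2, by positivity, fun y hy => h y ?_⟩
    rw [Real.sqrt_lt' hε]
    refine lt_of_le_of_lt ?_ hy
    rw [← x.inner_self, ← inner_sub_right, norm_sub_rev]
    exact (norm_inner_le_norm _ _).trans (by rw [x.norm_val, one_mul])

/-- The Euclidean topology is retained, so the Borel structure and the surface measure of the
ordinary sphere can be used unchanged. -/
noncomputable instance : PseudoMetricSpace (KoranyiSphere V) :=
  .ofDistTopology (fun P Q => √‖1 - inner ℂ P.val Q.val‖)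
    (fun P => by rw [P.inner_self]; simp)
    (fun P Q => by
      rw [← inner_conj_symm P.val Q.val, ← RCLike.norm_conj]; simp)
    (fun P Q R => sqrt_norm_one_sub_inner_le P.norm_val.le Q.norm_val R.norm_val.le)
    isOpen_iff_koranyi

theorem dist_def (P Q : KoranyiSphere V) : dist P Q = √‖1 - inner ℂ P.val Q.val‖ := rfl

theorem dist_le_iff {P Q : KoranyiSphere V} {δ : ℝ} (hδ : 0 ≤ δ) :
    dist P Q ≤ δ ↔ ‖1 - inner ℂ P.val Q.val‖ ≤ δ ^ 2 := by
  rw [dist_def, Real.sqrt_le_left hδ]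

theorem continuous_val : Continuous (val : KoranyiSphere V → V) :=
  continuous_subtype_val (p := fun x => x ∈ Metric.sphere (0 : V) 1)

instance [MeasurableSpace V] : MeasurableSpace (KoranyiSphere V) :=
  inferInstanceAs (MeasurableSpace (Metric.sphere (0 : V) 1))

instance [MeasurableSpace V] [BorelSpace V] : BorelSpace (KoranyiSphere V) :=
  inferInstanceAs (BorelSpace (Metric.sphere (0 : V) 1))

instance [SecondCountableTopology V] : SecondCountableTopology (KoranyiSphere V) :=
  inferInstanceAs (SecondCountableTopology (Metric.sphere (0 : V) 1))

/-- The surface measure on the sphere. -/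
noncomputable def surface [MeasurableSpace V] (μ : Measure V) : Measure (KoranyiSphere V) :=
  μ.toSphere

instance [MeasurableSpace V] [BorelSpace V] [FiniteDimensional ℝ V] (μ : Measure V)
    [μ.IsAddHaarMeasure] : IsFiniteMeasure (surface μ) :=
  inferInstanceAs (IsFiniteMeasure μ.toSphere)

/-- The set of vectors with direction in `A`. -/
def sector (A : Set (KoranyiSphere V)) : Set V := {w | ‖w‖⁻¹ • w ∈ val '' A}

/-- The part of the cone over `A` at distance at most `h` from the sphere. -/
def shell (A : Set (KoranyiSphere V)) (h : ℝ) : Set V :=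
  sector A ∩ {w | 1 - h ≤ ‖w‖ ∧ ‖w‖ < 1}

theorem ne_zero_of_mem_sector {A : Set (KoranyiSphere V)} {w : V} (hw : w ∈ sector A) :
    w ≠ 0 := by
  rintro rfl
  obtain ⟨P, -, hP⟩ := hw
  have := P.norm_val
  simp [hP] at this

theorem smul_mem_sector_iff {A : Set (KoranyiSphere V)} {w : V} {r : ℝ} (hr : 0 < r) :
    r • w ∈ sector A ↔ w ∈ sector A := by
  have : ‖r • w‖⁻¹ • r • w = ‖w‖⁻¹ • w := by
    rw [norm_smul, Real.norm_eq_abs, abs_of_pos hr, smul_smul, mul_inv, mul_right_comm,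
      inv_mul_cancel₀ hr.ne', one_mul]
  simp only [sector, mem_ofPred_eq, this]

open scoped Pointwise in
theorem Ioo_smul_eq_sector_inter_ball (A : Set (KoranyiSphere V)) :
    Ioo (0 : ℝ) 1 • (val '' A) = sector A ∩ Metric.ball 0 1 := by
  ext w
  constructor
  · rintro ⟨r, hr, _, ⟨P, hP, rfl⟩, rfl⟩
    refine ⟨(smul_mem_sector_iff hr.1).2 ⟨P, hP, by simp [P.norm_val]⟩, ?_⟩
    rw [mem_ball_zero_iff, norm_smul, P.norm_val, mul_one, Real.norm_eq_abs, abs_of_pos hr.1]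
    exact hr.2
  · rintro ⟨hw, hw1⟩
    have hw0 := norm_pos_iff.2 (ne_zero_of_mem_sector hw)
    refine ⟨‖w‖, ⟨hw0, by simpa using hw1⟩, ‖w‖⁻¹ • w, hw, ?_⟩
    simp [smul_smul, mul_inv_cancel₀ hw0.ne']

section Measure

variable [MeasurableSpace V] [BorelSpace V]

theorem measurableEmbedding_val : MeasurableEmbedding (val : KoranyiSphere V → V) :=
  MeasurableEmbedding.subtype_coe (s := Metric.sphere (0 : V) 1)
    Metric.isClosed_sphere.measurableSet

theorem measurableSet_sector {A : Set (KoranyiSphere V)} (hA : MeasurableSet A)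
    [SecondCountableTopology V] :
    MeasurableSet (sector A) := by
  have h := measurableEmbedding_val.measurableSet_image.2 hA
  have hm : Measurable fun w : V => ‖w‖⁻¹ • w := measurable_norm.inv.smul measurable_id
  exact hm h

variable [FiniteDimensional ℝ V] (μ : Measure V) [μ.IsAddHaarMeasure]

theorem surface_real_apply {A : Set (KoranyiSphere V)} (hA : MeasurableSet A) :
    (surface μ).real A = Module.finrank ℝ V * μ.real (sector A ∩ Metric.ball 0 1) := by
  have h := μ.toSphere_apply' (s := A) hA
  rw [← Ioo_smul_eq_sector_inter_ball, measureReal_def, measureReal_def]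
  change (μ.toSphere A).toReal = _
  rw [h, ENNReal.toReal_mul, ENNReal.toReal_natCast]
  rfl

theorem surface_eq_zero_iff [Nontrivial V] {A : Set (KoranyiSphere V)} (hA : MeasurableSet A) :
    surface μ A = 0 ↔ μ (sector A ∩ Metric.ball 0 1) = 0 := by
  have h := μ.toSphere_apply' (s := A) hA
  rw [← Ioo_smul_eq_sector_inter_ball]
  change μ.toSphere A = 0 ↔ _
  rw [h]
  simp [Module.finrank_pos.ne']
  rfl

theorem measureReal_sector_inter_ball (A : Set (KoranyiSphere V)) {r : ℝ} (hr : 0 < r) :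
    μ.real (sector A ∩ Metric.ball 0 r) =
      r ^ Module.finrank ℝ V * μ.real (sector A ∩ Metric.ball 0 1) := by
  have : sector A ∩ Metric.ball 0 r = (fun x => r⁻¹ • x) ⁻¹' (sector A ∩ Metric.ball 0 1) := by
    ext w
    simp only [mem_inter_iff, mem_preimage, smul_mem_sector_iff (inv_pos.2 hr), mem_ball_zero_iff,
      norm_smul, norm_inv, Real.norm_eq_abs, abs_of_pos hr]
    rw [inv_mul_lt_iff₀ hr, mul_one]
  rw [this, measureReal_def, Measure.addHaar_preimage_smul _ (inv_ne_zero hr.ne'),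
    ENNReal.toReal_mul, ENNReal.toReal_ofReal (abs_nonneg _), inv_pow, inv_inv,
    abs_of_pos (by positivity)]
  rfl

/-- Homogeneity of volume. For small `h` the shell has volume comparable to `h` times the surface of
`A`, which converts between volume estimates near the sphere and surface estimates. -/
theorem finrank_mul_measureReal_shell {A : Set (KoranyiSphere V)} (hA : MeasurableSet A) {h : ℝ}
    (h0 : 0 ≤ h) (h1 : h < 1) : Module.finrank ℝ V * μ.real (shell A h) =
      (1 - (1 - h) ^ Module.finrank ℝ V) * (surface μ).real A := by
  have hsplit : shell A h = (sector A ∩ Metric.ball 0 1) \ (sector A ∩ Metric.ball 0 (1 - h)) := by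
    ext w
    simp only [shell, mem_inter_iff, mem_ofPred_eq, Set.mem_sdiff, mem_ball_zero_iff, not_and, not_lt]
    tauto
  have hfin : μ (sector A ∩ Metric.ball 0 1) ≠ ⊤ :=
    ((measure_mono inter_subset_right).trans_lt measure_ball_lt_top).ne
  rw [hsplit, measureReal_sdiff, measureReal_sector_inter_ball μ A (r := 1 - h) (by linarith),
    surface_real_apply μ hA]
  · ring
  · exact inter_subset_inter_right _ (Metric.ball_subset_ball (by linarith))
  · exact (measurableSet_sector hA).inter Metric.isOpen_ball.measurableSet

end Measure

end KoranyiSphere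

end KoranyiDistance

/-! ### Anisotropic dilations and ellipsoids. -/

section AnisotropicDilation

variable {V : Type*} [NormedAddCommGroup V] [InnerProductSpace ℂ V]

/-- The dilation with factor `s ^ 2` in the complex direction `ζ` and `s` orthogonally to it. -/
noncomputable def anisotropicDilation (ζ : V) (s : ℝ) : V →L[ℂ] V :=
  (s : ℂ) • ContinuousLinearMap.id ℂ V + ((s ^ 2 - s : ℝ) : ℂ) • (innerSL ℂ ζ).smulRight ζ

theorem anisotropicDilation_apply (ζ : V) (s : ℝ) (v : V) :
    anisotropicDilation ζ s v = (s : ℂ) • v + (((s ^ 2 - s : ℝ) : ℂ) * inner ℂ ζ v) • ζ := by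
  simp [anisotropicDilation, smul_smul]

theorem inner_anisotropicDilation {ζ : V} (hζ : ‖ζ‖ = 1) (s : ℝ) (v : V) :
    inner ℂ ζ (anisotropicDilation ζ s v) = (s : ℂ) ^ 2 * inner ℂ ζ v := by
  rw [anisotropicDilation_apply, inner_add_right, inner_smul_right, inner_smul_right,
    inner_self_eq_norm_sq_to_K, hζ]
  push_cast
  ring_nf

theorem anisotropicDilation_orthogonal {ζ : V} (hζ : ‖ζ‖ = 1) (s : ℝ) (v : V) :
    anisotropicDilation ζ s v - inner ℂ ζ (anisotropicDilation ζ s v) • ζ =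
      (s : ℂ) • (v - inner ℂ ζ v • ζ) := by
  rw [inner_anisotropicDilation hζ, anisotropicDilation_apply]
  push_cast
  module

theorem anisotropicDilation_mul {ζ : V} (hζ : ‖ζ‖ = 1) (s t : ℝ) (v : V) :
    anisotropicDilation ζ s (anisotropicDilation ζ t v) = anisotropicDilation ζ (s * t) v := by
  rw [anisotropicDilation_apply, inner_anisotropicDilation hζ, anisotropicDilation_apply,
    anisotropicDilation_apply]
  push_cast
  module

theorem anisotropicDilation_one (ζ v : V) : anisotropicDilation ζ 1 v = v := by
  rw [anisotropicDilation_apply]; simp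

theorem norm_anisotropicDilation_le {ζ : V} (hζ : ‖ζ‖ = 1) {s : ℝ} (hs : 1 ≤ s) (v : V) :
    ‖anisotropicDilation ζ s v‖ ≤ s ^ 2 * ‖v‖ := by
  apply le_of_sq_le_sq _ (by positivity)
  rw [norm_sq_eq_add_orthogonal hζ, anisotropicDilation_orthogonal hζ, mul_pow, norm_sq_eq_add_orthogonal hζ v,
    inner_anisotropicDilation hζ, norm_mul, norm_smul, norm_pow, Complex.norm_real,
    Real.norm_eq_abs, abs_of_pos (by linarith)]
  have : s ^ 2 ≤ (s ^ 2) ^ 2 := le_self_pow₀ (by nlinarith) (by norm_num)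
  nlinarith [sq_nonneg ‖v - inner ℂ ζ v • ζ‖]

/-- The points of the ellipsoid centred at `(1 - h) ζ`, with radii comparable to `h` in the complex
direction `ζ` and to `√h` orthogonally, lie at distance comparable to `h` from the sphere. -/
theorem ellipsoid_estimates {ζ : V} (hζ : ‖ζ‖ = 1) {h : ℝ} (h0 : 0 < h) (h1 : h ≤ 1) {v : V}
    (hv : ‖v‖ ≤ 1) {w : V} (hw : w = ((1 - h : ℝ) : ℂ) • ζ + anisotropicDilation ζ (√h / 4) v) :
    ‖w‖ ≤ 1 - h / 2 ∧ 1 - 2 * h ≤ ‖w‖ ∧ ‖1 - inner ℂ ζ w‖ ≤ 2 * h := by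
  -- The factor 4 makes both the deviation along `ζ` and the squared orthogonal part at most `h /
  -- 16`, small against the height `h` of the centre.
  have hs2 : (√h / 4) ^ 2 = h / 16 := by rw [div_pow, Real.sq_sqrt h0.le]; norm_num
  have hin : inner ℂ ζ w = ((1 - h : ℝ) : ℂ) + ((h / 16 : ℝ) : ℂ) * inner ℂ ζ v := by
    rw [hw, inner_add_right, inner_smul_right, inner_anisotropicDilation hζ,
      inner_self_eq_norm_sq_to_K, hζ, ← hs2]
    push_cast; simp
  have horth : w - inner ℂ ζ w • ζ = ((√h / 4 : ℝ) : ℂ) • (v - inner ℂ ζ v • ζ) := by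
    rw [← anisotropicDilation_orthogonal hζ, hw, inner_add_right, inner_smul_right,
      inner_self_eq_norm_sq_to_K, hζ]
    simp only [one_pow, mul_one, RCLike.ofReal_one]
    module
  have hvζ : ‖inner ℂ ζ v‖ ≤ 1 := (norm_inner_le_norm _ _).trans (by rw [hζ]; linarith)
  have hsmall : ‖((h / 16 : ℝ) : ℂ) * inner ℂ ζ v‖ ≤ h / 16 := by
    rw [norm_mul, Complex.norm_real, Real.norm_eq_abs, abs_of_pos (by positivity)]
    nlinarith
  have hn1 : ‖((1 - h : ℝ) : ℂ)‖ = 1 - h := by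
    rw [Complex.norm_real, Real.norm_eq_abs, abs_of_nonneg (by linarith)]
  have hup : ‖inner ℂ ζ w‖ ≤ 1 - h + h / 16 := by
    rw [hin]; exact (norm_add_le _ _).trans (by rw [hn1]; linarith)
  have hlow : 1 - h - h / 16 ≤ ‖inner ℂ ζ w‖ := by
    rw [hin]
    have := norm_sub_le_norm_add ((1 - h : ℝ) : ℂ) (((h / 16 : ℝ) : ℂ) * inner ℂ ζ v)
    rw [hn1] at this
    linarith
  have hort : ‖w - inner ℂ ζ w • ζ‖ ^ 2 ≤ h / 16 := by
    rw [horth, norm_smul, mul_pow, Complex.norm_real, Real.norm_eq_abs, sq_abs, hs2]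
    have h3 := norm_sq_eq_add_orthogonal hζ v
    have : ‖v‖ ^ 2 ≤ 1 := by nlinarith [norm_nonneg v]
    have : ‖v - inner ℂ ζ v • ζ‖ ^ 2 ≤ 1 := by nlinarith [sq_nonneg ‖inner ℂ ζ v‖]
    nlinarith
  refine ⟨?_, ?_, ?_⟩
  · apply le_of_sq_le_sq _ (by linarith)
    rw [norm_sq_eq_add_orthogonal hζ w]
    nlinarith [norm_nonneg (inner ℂ ζ w)]
  · have : ‖inner ℂ ζ w‖ ≤ ‖w‖ := (norm_inner_le_norm _ _).trans (by rw [hζ, one_mul])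
    linarith
  · have : 1 - inner ℂ ζ w = ((h : ℝ) : ℂ) - ((h / 16 : ℝ) : ℂ) * inner ℂ ζ v := by
      rw [hin]; push_cast; ring
    rw [this]
    refine (norm_sub_le _ _).trans ?_
    rw [Complex.norm_real, Real.norm_eq_abs, abs_of_pos h0]
    linarith

theorem norm_one_sub_inner_normalize_le {ζ w : V} (hζ : ‖ζ‖ = 1) (hw0 : w ≠ 0) (hw1 : ‖w‖ ≤ 1) :
    ‖1 - inner ℂ ζ (‖w‖⁻¹ • w)‖ ≤ ‖1 - inner ℂ ζ w‖ + (1 - ‖w‖) := by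
  have hn := norm_pos_iff.2 hw0
  have h1 : ‖w - ‖w‖⁻¹ • w‖ = 1 - ‖w‖ := by
    have : w - ‖w‖⁻¹ • w = (1 - ‖w‖⁻¹) • w := by rw [sub_smul, one_smul]
    rw [this, norm_smul, Real.norm_eq_abs, abs_of_nonpos, neg_sub, sub_mul, inv_mul_cancel₀ hn.ne',
      one_mul]
    rw [sub_nonpos]; exact (one_le_inv₀ hn).2 hw1
  have h2 : 1 - inner ℂ ζ (‖w‖⁻¹ • w) = (1 - inner ℂ ζ w) + inner ℂ ζ (w - ‖w‖⁻¹ • w) := by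
    rw [inner_sub_right]; ring
  rw [h2]
  refine (norm_add_le _ _).trans ?_
  gcongr
  exact (norm_inner_le_norm _ _).trans (by rw [hζ, one_mul, h1])

/-- The factor by which an anisotropic dilation multiplies volumes. -/
noncomputable def dilationFactor (ζ : V) (s : ℝ) : ℝ :=
  |LinearMap.det ((anisotropicDilation ζ s : V →ₗ[ℂ] V).restrictScalars ℝ)|

theorem dilationFactor_nonneg (ζ : V) (s : ℝ) : 0 ≤ dilationFactor ζ s := abs_nonneg _

theorem dilationFactor_mul {ζ : V} (hζ : ‖ζ‖ = 1) (s t : ℝ) :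
    dilationFactor ζ (s * t) = dilationFactor ζ s * dilationFactor ζ t := by
  rw [dilationFactor, dilationFactor, dilationFactor, ← abs_mul, ← LinearMap.det_comp]
  congr 2
  ext v
  simp [anisotropicDilation_mul hζ]

theorem dilationFactor_pos {ζ : V} (hζ : ‖ζ‖ = 1) {s : ℝ} (hs : s ≠ 0) :
    0 < dilationFactor ζ s := by
  refine lt_of_le_of_ne (dilationFactor_nonneg _ _) fun h => ?_
  have h1 := dilationFactor_mul hζ s s⁻¹
  rw [← h, zero_mul, mul_inv_cancel₀ hs, dilationFactor] at h1
  have : ((anisotropicDilation ζ 1 : V →ₗ[ℂ] V).restrictScalars ℝ) = LinearMap.id := by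
    ext v; simp [anisotropicDilation_one]
  rw [this, LinearMap.det_id] at h1
  simp at h1

section Measure

variable [MeasurableSpace V] [BorelSpace V] [FiniteDimensional ℝ V] (μ : Measure V)
  [μ.IsAddHaarMeasure]

theorem measureReal_image_anisotropicDilation (ζ : V) (s : ℝ) (A : Set V) :
    μ.real (anisotropicDilation ζ s '' A) = dilationFactor ζ s * μ.real A := by
  have h := Measure.addHaar_image_linearMap μ
    ((anisotropicDilation ζ s : V →ₗ[ℂ] V).restrictScalars ℝ) A
  rw [measureReal_def]
  change (μ (((anisotropicDilation ζ s : V →ₗ[ℂ] V).restrictScalars ℝ) '' A)).toReal = _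
  rw [h, ENNReal.toReal_mul, ENNReal.toReal_ofReal (abs_nonneg _)]
  rfl

theorem measureReal_ball_pos : 0 < μ.real (Metric.ball (0 : V) 1) :=
  ENNReal.toReal_pos (Metric.measure_ball_pos μ _ one_pos).ne' measure_ball_lt_top.ne

theorem measureReal_preimage_add (a : V) (A : Set V) :
    μ.real ((fun x => a + x) ⁻¹' A) = μ.real A := by
  rw [measureReal_def, measure_preimage_add, measureReal_def]

theorem measureReal_ball_eq {r : ℝ} (hr : 0 < r) : μ.real (Metric.ball (0 : V) r) =
    r ^ Module.finrank ℝ V * μ.real (Metric.ball (0 : V) 1) := by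
  rw [measureReal_def, Measure.addHaar_ball_of_pos μ _ hr, ENNReal.toReal_mul,
    ENNReal.toReal_ofReal (by positivity)]
  rfl

/-- A crude bound, from the inclusion of the dilated unit ball in the ball of radius `s ^ 2`. It
suffices because, by multiplicativity, only ratios at comparable scales enter. -/
theorem dilationFactor_le (ν : Measure V) [ν.IsAddHaarMeasure] {ζ : V} (hζ : ‖ζ‖ = 1) {s : ℝ} (hs : 1 ≤ s) :
    dilationFactor ζ s ≤ (s ^ 2) ^ Module.finrank ℝ V := by
  have h1 : anisotropicDilation ζ s '' Metric.ball 0 1 ⊆ Metric.ball 0 (s ^ 2) := by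
    rintro _ ⟨v, hv, rfl⟩
    rw [mem_ball_zero_iff] at hv ⊢
    have := norm_anisotropicDilation_le hζ hs v
    have : 0 < s ^ 2 := by positivity
    nlinarith
  have h2 := measureReal_mono (μ := ν) h1 measure_ball_lt_top.ne
  rw [measureReal_image_anisotropicDilation,
    measureReal_ball_eq ν (show 0 < s ^ 2 by positivity)] at h2
  exact le_of_mul_le_mul_right h2 (measureReal_ball_pos ν)

end Measure

end AnisotropicDilation

/-! ### The surface measure is doubling for the Korányi metric. -/

namespace KoranyiSphere

variable {V : Type*} [NormedAddCommGroup V] [InnerProductSpace ℂ V]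
  [MeasurableSpace V] [BorelSpace V] [FiniteDimensional ℝ V] (μ : Measure V) [μ.IsAddHaarMeasure]

theorem measure_shell_ne_top (A : Set (KoranyiSphere V)) (h : ℝ) : μ (shell A h) ≠ ⊤ := by
  have : shell A h ⊆ Metric.ball 0 1 := fun w hw => by simpa using hw.2.2
  exact ((measure_mono this).trans_lt measure_ball_lt_top).ne

theorem measureReal_shell_le [Nontrivial V] {A : Set (KoranyiSphere V)} (hA : MeasurableSet A)
    {h : ℝ} (h0 : 0 ≤ h) (h1 : h < 1) : μ.real (shell A h) ≤ h * (surface μ).real A := by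
  have hd : (0 : ℝ) < Module.finrank ℝ V := by exact_mod_cast Module.finrank_pos
  have h2 := finrank_mul_measureReal_shell μ hA h0 h1
  have h3 := one_add_mul_le_pow (a := -h) (by linarith) (Module.finrank ℝ V)
  rw [← sub_eq_add_neg] at h3
  refine le_of_mul_le_mul_left ?_ hd
  rw [h2, ← mul_assoc]
  gcongr
  linarith

theorem mul_surface_le [Nontrivial V] {A : Set (KoranyiSphere V)} (hA : MeasurableSet A)
    {h : ℝ} (h0 : 0 ≤ h) (h1 : h < 1) :
    h * (surface μ).real A ≤ Module.finrank ℝ V * μ.real (shell A h) := by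
  rw [finrank_mul_measureReal_shell μ hA h0 h1]
  gcongr
  have := pow_le_of_le_one (a := 1 - h) (by linarith) (by linarith)
    (Module.finrank_pos (R := ℝ) (M := V)).ne'
  linarith

/-- The shell of thickness `δ ^ 2` over the Korányi ball lies in the translate to `ζ` of the
`δ`-dilate of a Euclidean ball; radius 4 is enough since the undilated points have squared norm at
most 6. -/
theorem surface_closedBall_le [Nontrivial V] (ζ : KoranyiSphere V) {δ : ℝ} (hδ : 0 < δ)
    (hδ1 : δ < 1) : δ ^ 2 * (surface μ).real (Metric.closedBall ζ δ) ≤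
      Module.finrank ℝ V * (dilationFactor ζ.val δ *
        (4 ^ Module.finrank ℝ V * μ.real (Metric.ball (0 : V) 1))) := by
  refine (mul_surface_le μ Metric.isClosed_closedBall.measurableSet (by positivity)
    (by nlinarith)).trans ?_
  gcongr
  rw [← measureReal_ball_eq μ (by norm_num), ← measureReal_image_anisotropicDilation,
    ← measureReal_preimage_add μ (-ζ.val) (_ '' _)]
  refine measureReal_mono ?_ ?_
  · rintro w ⟨⟨ω, hω, hωw⟩, hw1, hw2⟩
    have hζ := ζ.norm_val
    set r := ‖w‖
    have hr0 : 0 < r := by nlinarith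
    have hw : w = r • ω.val := by rw [hωw, smul_smul, mul_inv_cancel₀ hr0.ne', one_smul]
    rw [Metric.mem_closedBall, dist_comm, dist_le_iff hδ.le] at hω
    refine ⟨anisotropicDilation ζ.val δ⁻¹ (-ζ.val + w), ?_, ?_⟩
    · have hin : ‖inner ℂ ζ.val (-ζ.val + w)‖ ≤ 2 * δ ^ 2 := by
        have : inner ℂ ζ.val (-ζ.val + w) = -((r : ℂ) * (1 - inner ℂ ζ.val ω.val) + ((1 - r : ℝ) : ℂ)) := by
          rw [inner_add_right, inner_neg_right, ζ.inner_self, hw, ← Complex.coe_smul, inner_smul_right]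
          push_cast; ring
        rw [this, norm_neg]
        refine (norm_add_le _ _).trans ?_
        rw [norm_mul, Complex.norm_real, Complex.norm_real, Real.norm_eq_abs, Real.norm_eq_abs,
          abs_of_pos hr0, abs_of_pos (by linarith)]
        nlinarith [norm_nonneg (1 - inner ℂ ζ.val ω.val)]
      have horth : ‖(-ζ.val + w) - inner ℂ ζ.val (-ζ.val + w) • ζ.val‖ ^ 2 ≤ 2 * δ ^ 2 := by
        have : (-ζ.val + w) - inner ℂ ζ.val (-ζ.val + w) • ζ.val =
            (r : ℂ) • (ω.val - inner ℂ ζ.val ω.val • ζ.val) := by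
          rw [inner_add_right, inner_neg_right, ζ.inner_self, hw, ← Complex.coe_smul, inner_smul_right]
          module
        rw [this, norm_smul, mul_pow, Complex.norm_real, Real.norm_eq_abs, sq_abs]
        have := norm_orthogonal_sq_le hζ ω.norm_val.le
        have : r ^ 2 ≤ 1 := by nlinarith
        nlinarith [sq_nonneg ‖ω.val - inner ℂ ζ.val ω.val • ζ.val‖]
      rw [mem_ball_zero_iff]
      apply lt_of_pow_lt_pow_left₀ 2 (by norm_num)
      rw [norm_sq_eq_add_orthogonal hζ, anisotropicDilation_orthogonal hζ,
        inner_anisotropicDilation hζ, norm_mul, norm_smul, norm_pow, Complex.norm_real,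
        Real.norm_eq_abs, abs_of_pos (by positivity), mul_pow, mul_pow]
      calc _ ≤ ((δ⁻¹ ^ 2) ^ 2 * (2 * δ ^ 2) ^ 2 + δ⁻¹ ^ 2 * (2 * δ ^ 2)) := by gcongr
        _ = 6 := by field_simp; norm_num
        _ < 4 ^ 2 := by norm_num
    · rw [anisotropicDilation_mul hζ, mul_inv_cancel₀ hδ.ne', anisotropicDilation_one]
  · rw [measure_preimage_add]
    exact ((anisotropicDilation ζ.val δ).lipschitz.isBounded_image
      Metric.isBounded_ball).measure_lt_top.ne

theorem mem_shell_of_ellipsoid (ζ : KoranyiSphere V) {h : ℝ} (h0 : 0 < h) (h1 : 2 * h < 1)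
    {v : V} (hv : ‖v‖ < 1) : ((1 - h : ℝ) : ℂ) • ζ.val + anisotropicDilation ζ.val (√h / 4) v ∈
      shell (Metric.closedBall ζ (2 * √h)) (2 * h) := by
  generalize hvw : ((1 - h : ℝ) : ℂ) • ζ.val + anisotropicDilation ζ.val (√h / 4) v = w
  obtain ⟨e1, e2, e3⟩ := ellipsoid_estimates ζ.norm_val h0 (by linarith) hv.le hvw.symm
  have hw0 : w ≠ 0 := norm_pos_iff.1 (by linarith)
  refine ⟨⟨direction w hw0, ?_, val_direction w hw0⟩, by linarith, by linarith⟩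
  rw [Metric.mem_closedBall, dist_comm, dist_le_iff (by positivity), mul_pow, Real.sq_sqrt h0.le,
    val_direction]
  exact (norm_one_sub_inner_normalize_le ζ.norm_val hw0 (by linarith)).trans (by linarith)

/-- The matching lower bound: the shell over a Korányi ball of radius `2 * √h` contains an
ellipsoid. -/
theorem dilationFactor_mul_le [Nontrivial V] (ζ : KoranyiSphere V) {h : ℝ} (h0 : 0 < h)
    (h1 : 2 * h < 1) : dilationFactor ζ.val (√h / 4) * μ.real (Metric.ball (0 : V) 1) ≤
      2 * h * (surface μ).real (Metric.closedBall ζ (2 * √h)) := by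
  refine le_trans ?_ (measureReal_shell_le μ Metric.isClosed_closedBall.measurableSet
    (by positivity) h1)
  rw [← measureReal_image_anisotropicDilation,
    ← measureReal_preimage_add μ (((1 - h : ℝ) : ℂ) • ζ.val) (shell _ _)]
  refine measureReal_mono ?_ (by rw [measure_preimage_add]; exact measure_shell_ne_top _ _ _)
  rintro _ ⟨v, hv, rfl⟩
  exact mem_shell_of_ellipsoid ζ h0 h1 (by simpa using hv)

/-- The upper bound at radius `2 * δ` and the lower bound at radius `δ`, that is `h = δ ^ 2 / 4`,
involve dilations by `2 * δ` and `δ / 8`, whose ratio is 16. -/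
instance [Nontrivial V] : IsUnifLocDoublingMeasure (surface μ) := by
  set d := Module.finrank ℝ V
  set b := μ.real (Metric.ball (0 : V) 1)
  set C : ℝ := d * 4 ^ d * (16 ^ 2) ^ d / 8 with hC
  have hC0 : 0 ≤ C := by positivity
  refine ⟨C.toNNReal, ?_⟩
  filter_upwards [Ioo_mem_nhdsGT (show (0 : ℝ) < 1 / 2 by norm_num)] with δ hδ ζ
  obtain ⟨h0, h1⟩ := hδ
  have hsqrt : √(δ ^ 2 / 4) = δ / 2 := by
    rw [show δ ^ 2 / 4 = (δ / 2) ^ 2 by ring, Real.sqrt_sq (by positivity)]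
  have u := surface_closedBall_le μ ζ (δ := 2 * δ) (by positivity) (by linarith)
  have l := dilationFactor_mul_le μ ζ (h := δ ^ 2 / 4) (by positivity) (by nlinarith)
  rw [hsqrt, show 2 * (δ / 2) = δ by ring] at l
  have hf : dilationFactor ζ.val (2 * δ) ≤ (16 ^ 2) ^ d * dilationFactor ζ.val (δ / 2 / 4) := by
    rw [show 2 * δ = 16 * (δ / 2 / 4) by ring, dilationFactor_mul ζ.norm_val]
    gcongr
    · exact dilationFactor_nonneg _ _
    · exact dilationFactor_le μ ζ.norm_val (by norm_num)
  have key : (surface μ).real (Metric.closedBall ζ (2 * δ)) ≤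
      C * (surface μ).real (Metric.closedBall ζ δ) := by
    refine le_of_mul_le_mul_left ?_ (show 0 < (2 * δ) ^ 2 by positivity)
    calc _ ≤ _ := u
      _ ≤ d * ((16 ^ 2) ^ d * dilationFactor ζ.val (δ / 2 / 4) * (4 ^ d * b)) := by gcongr
      _ = d * (16 ^ 2) ^ d * 4 ^ d * (dilationFactor ζ.val (δ / 2 / 4) * b) := by ring
      _ ≤ d * (16 ^ 2) ^ d * 4 ^ d *
          (2 * (δ ^ 2 / 4) * (surface μ).real (Metric.closedBall ζ δ)) := by gcongr
      _ = _ := by rw [hC]; ring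
  rw [← ofReal_measureReal (measure_ne_top _ _), ← ofReal_measureReal (measure_ne_top _ _),
    ENNReal.ofNNReal_toNNReal, ← ENNReal.ofReal_mul hC0]
  exact ENNReal.ofReal_le_ofReal key

end KoranyiSphere

/-! ### Circle orbits and the sub-mean value property. -/

section CircleAction

variable {V : Type*} [NormedAddCommGroup V] [InnerProductSpace ℂ V]
  [MeasurableSpace V] [BorelSpace V] [FiniteDimensional ℝ V] (μ : Measure V) [μ.IsAddHaarMeasure]

/-- A linear map scales all volumes by one factor, which is 1 here because the unit ball is
preserved. -/
theorem measure_image_unit_smul {c : ℂ} (hc : ‖c‖ = 1) (A : Set V) :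
    μ ((fun v => c • v) '' A) = μ A := by
  have h := Measure.addHaar_image_linearMap μ ((c • LinearMap.id : V →ₗ[ℂ] V).restrictScalars ℝ)
  have himg : ∀ A : Set V, ((c • LinearMap.id : V →ₗ[ℂ] V).restrictScalars ℝ) '' A =
      (fun v => c • v) '' A := fun A => rfl
  simp only [himg] at h
  have hball : (fun v : V => c • v) '' Metric.ball 0 1 = Metric.ball 0 1 := by
    have hc0 : c ≠ 0 := fun h => by simp [h] at hc
    ext w
    constructor
    · rintro ⟨v, hv, rfl⟩
      simpa [norm_smul, hc] using hv
    · intro hw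
      refine ⟨c⁻¹ • w, by simpa [norm_smul, hc] using hw, ?_⟩
      simp [smul_smul, mul_inv_cancel₀ hc0]
  have h1 := h (Metric.ball 0 1)
  rw [hball] at h1
  have h2 := (ENNReal.mul_eq_right (Metric.measure_ball_pos μ _ one_pos).ne'
    measure_ball_lt_top.ne).1 h1.symm
  rw [h A, h2, one_mul]

theorem measurePreserving_unit_smul {c : ℂ} (hc : ‖c‖ = 1) :
    MeasurePreserving (fun v : V => c • v) μ μ := by
  have hc0 : c ≠ 0 := fun h => by simp [h] at hc
  have hm : Measurable fun v : V => c • v := (continuous_const_smul c).measurable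
  refine ⟨hm, Measure.ext fun A hA => ?_⟩
  rw [Measure.map_apply hm hA, ← measure_image_unit_smul μ hc]
  congr 1
  refine image_preimage_eq A fun w => ⟨c⁻¹ • w, ?_⟩
  simp [smul_smul, mul_inv_cancel₀ hc0]

/-- Integration over a space with a circle action can be performed over the orbits. -/
theorem lintegral_lintegral_circle {φ : V → ENNReal} (hφ : Measurable φ) :
    ∫⁻ v, (∫⁻ θ in Ioc (0 : ℝ) (2 * Real.pi), φ (Complex.exp (θ * Complex.I) • v)) ∂μ =
      ENNReal.ofReal (2 * Real.pi) * ∫⁻ v, φ v ∂μ := by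
  have hcont : Continuous fun p : V × ℝ => Complex.exp (p.2 * Complex.I) • p.1 := by fun_prop
  rw [lintegral_lintegral_swap
    (f := fun (v : V) (θ : ℝ) => φ (Complex.exp (θ * Complex.I) • v))
    (hφ.comp hcont.measurable).aemeasurable]
  have : ∀ θ : ℝ, ∫⁻ v, φ (Complex.exp (θ * Complex.I) • v) ∂μ = ∫⁻ v, φ v ∂μ := fun θ =>
    (measurePreserving_unit_smul μ (Complex.norm_exp_ofReal_mul_I θ)).lintegral_comp hφ
  simp only [this]
  rw [lintegral_const, Measure.restrict_apply MeasurableSet.univ, univ_inter, Real.volume_Ioc,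
    sub_zero, mul_comm]

/-- A measurable set meeting almost no point of each circle orbit is null. -/
theorem measure_eq_zero_of_circle {N : Set V} (hN : MeasurableSet N)
    (h : ∀ v, volume {θ : ℝ | Complex.exp (θ * Complex.I) • v ∈ N} = 0) : μ N = 0 := by
  have h1 := lintegral_lintegral_circle μ ((measurable_indicator_const_iff 1).2 hN :
    Measurable (N.indicator fun _ => (1 : ENNReal)))
  have h2 : ∀ v, ∫⁻ θ in Ioc (0 : ℝ) (2 * Real.pi),
      N.indicator (fun _ => (1 : ENNReal)) (Complex.exp (θ * Complex.I) • v) = 0 := by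
    intro v
    refine le_antisymm ((setLIntegral_le_lintegral _ _).trans ?_) (zero_le)
    have : (fun θ : ℝ => N.indicator (fun _ => (1 : ENNReal)) (Complex.exp (θ * Complex.I) • v)) =ᵐ[volume]
        fun _ => 0 := by
      refine measure_mono_null (fun θ hθ => ?_) (h v)
      by_contra hcon
      exact hθ (indicator_of_notMem (s := N) hcon _)
    rw [lintegral_congr_ae this, lintegral_zero]
  simp only [h2, lintegral_zero, lintegral_indicator_const hN, one_mul] at h1
  have h3 := (mul_eq_zero.1 h1.symm).resolve_left (by simp [Real.pi_pos])
  exact h3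

/-- The sub-mean value property of holomorphic functions on the unit ball. -/
theorem enorm_mul_measure_ball_le {g : V → ℂ} (hg : DifferentiableOn ℂ g (Metric.ball 0 1)) :
    ‖g 0‖ₑ * μ (Metric.ball 0 1) ≤ ∫⁻ v in Metric.ball 0 1, ‖g v‖ₑ ∂μ := by
  set φ : V → ENNReal := (Metric.ball 0 1).indicator fun v => ‖g v‖ₑ with hφdef
  have hφ : Measurable φ := by
    classical
    rw [hφdef, ← piecewise_eq_indicator]
    exact ContinuousOn.measurable_piecewise (continuous_enorm.comp_continuousOn hg.continuousOn)
      continuousOn_const Metric.isOpen_ball.measurableSet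
  -- The one-variable mean value property of `l ↦ g (l • v)` on the unit circle; integrating over
  -- `v` gives the claim.
  have hmean : ∀ v ∈ Metric.ball (0 : V) 1, ENNReal.ofReal (2 * Real.pi) * ‖g 0‖ₑ ≤
      ∫⁻ θ in Ioc (0 : ℝ) (2 * Real.pi), φ (Complex.exp (θ * Complex.I) • v) := by
    intro v hv
    rw [mem_ball_zero_iff] at hv
    have hd : DiffContOnCl ℂ (fun l : ℂ => g (l • v)) (Metric.ball 0 |1|) := by
      apply DifferentiableOn.diffContOnCl
      intro l hl
      have hl1 : ‖l‖ ≤ 1 := by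
        simpa using Metric.closure_ball_subset_closedBall hl
      have hlv : l • v ∈ Metric.ball (0 : V) 1 := by
        rw [mem_ball_zero_iff, norm_smul]
        nlinarith [norm_nonneg v]
      have := (hg.differentiableAt (Metric.isOpen_ball.mem_nhds hlv))
      exact (this.comp (f := fun l : ℂ => l • v) l (by fun_prop)).differentiableWithinAt
    have h := hd.circleAverage
    rw [zero_smul, Real.circleAverage_def] at h
    have h2 : (2 * Real.pi : ℝ) • g 0 = ∫ θ in (0 : ℝ)..2 * Real.pi, g (circleMap 0 1 θ • v) := by
      rw [← h, smul_smul, mul_inv_cancel₀ (by positivity), one_smul]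
    calc ENNReal.ofReal (2 * Real.pi) * ‖g 0‖ₑ = ‖(2 * Real.pi : ℝ) • g 0‖ₑ := by
          rw [enorm_smul, Real.enorm_of_nonneg (by positivity)]
      _ ≤ ∫⁻ θ in Ioc (0 : ℝ) (2 * Real.pi), ‖g (circleMap 0 1 θ • v)‖ₑ := by
          rw [h2, intervalIntegral.integral_of_le (by positivity)]
          exact enorm_integral_le_lintegral_enorm _
      _ = _ := by
          refine lintegral_congr fun θ => ?_
          have hmem : Complex.exp (θ * Complex.I) • v ∈ Metric.ball (0 : V) 1 := by
            rw [mem_ball_zero_iff, norm_smul, Complex.norm_exp_ofReal_mul_I, one_mul]; exact hv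
          rw [hφdef, indicator_of_mem hmem, circleMap]
          simp
  have hpi : ENNReal.ofReal (2 * Real.pi) ≠ 0 := by simp [Real.pi_pos]
  rw [← ENNReal.mul_le_mul_iff_right hpi ENNReal.ofReal_ne_top, ← mul_assoc,
    ← lintegral_indicator Metric.isOpen_ball.measurableSet, ← lintegral_lintegral_circle μ hφ,
    ← setLIntegral_const]
  exact (setLIntegral_mono' Metric.isOpen_ball.measurableSet hmean).trans
    (setLIntegral_le_lintegral _ _)

/-- A bounded holomorphic function on the unit ball which is small outside of a small set is small
at the centre. -/
theorem norm_mul_measureReal_ball_le {g : V → ℂ} (hg : DifferentiableOn ℂ g (Metric.ball 0 1))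
    {ε M : ℝ} (hε : 0 ≤ ε) (hM0 : 0 ≤ M) {T : Set V} (hT : MeasurableSet T)
    (hsmall : ∀ v ∈ Metric.ball 0 1, v ∉ T → ‖g v‖ ≤ ε)
    (hM : ∀ v ∈ Metric.ball 0 1, ‖g v‖ ≤ M) :
    ‖g 0‖ * μ.real (Metric.ball 0 1) ≤
      ε * μ.real (Metric.ball 0 1) + M * μ.real (Metric.ball 0 1 ∩ T) := by
  have hb : μ (Metric.ball (0 : V) 1) ≠ ⊤ := measure_ball_lt_top.ne
  have hbT : μ (Metric.ball (0 : V) 1 ∩ T) ≠ ⊤ :=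
    ((measure_mono inter_subset_left).trans_lt measure_ball_lt_top).ne
  have h1 : ∀ v ∈ Metric.ball (0 : V) 1,
      ‖g v‖ₑ ≤ ENNReal.ofReal ε + T.indicator (fun _ => ENNReal.ofReal M) v := by
    intro v hv
    rw [← ofReal_norm]
    by_cases hvT : v ∈ T
    · rw [indicator_of_mem hvT]
      exact (ENNReal.ofReal_le_ofReal (hM v hv)).trans le_add_self
    · rw [indicator_of_notMem hvT, add_zero]
      exact ENNReal.ofReal_le_ofReal (hsmall v hv hvT)
  have h2 := (enorm_mul_measure_ball_le μ hg).trans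
    (setLIntegral_mono' Metric.isOpen_ball.measurableSet h1)
  rw [lintegral_add_left measurable_const, setLIntegral_const, lintegral_indicator_const hT,
    Measure.restrict_apply hT, inter_comm] at h2
  have h3 := ENNReal.toReal_mono (by finiteness) h2
  rw [ENNReal.toReal_mul, ENNReal.toReal_add (by finiteness) (by finiteness), ENNReal.toReal_mul,
    ENNReal.toReal_mul, ENNReal.toReal_ofReal hε, ENNReal.toReal_ofReal hM0, toReal_enorm] at h3
  exact h3

end CircleAction

/-! ### Radial approximation almost everywhere. -/

namespace KoranyiSphere

variable {V : Type*} [NormedAddCommGroup V] [InnerProductSpace ℂ V] {f : V → ℂ}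

/-- The points at which `f` is bounded by `M` on the admissible region of aperture `α`. -/
def boundedSet (f : V → ℂ) (α M : ℝ) : Set (KoranyiSphere V) :=
  {P | ∀ z ∈ Metric.ball (0 : V) 1, ‖1 - inner ℂ P.val z‖ < α * (1 - ‖z‖) → ‖f z‖ ≤ M}

/-- The points above which `f` is `ε`-close to `c` on the radial segment from radius `r₀` on. -/
def radialSet (f : V → ℂ) (c : ℂ) (ε r₀ : ℝ) : Set (KoranyiSphere V) :=
  {P | ∀ r ∈ Ico r₀ 1, ‖f ((r : ℂ) • P.val) - c‖ ≤ ε}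

/-- For fixed `z`, lying in the region over `P` is an open condition on `P`. This supplies the
measurability needed for Fubini and density. -/
theorem isClosed_boundedSet (f : V → ℂ) (α M : ℝ) : IsClosed (boundedSet f α M) := by
  have : boundedSet f α M = ⋂ z ∈ {z ∈ Metric.ball (0 : V) 1 | M < ‖f z‖},
      {P | α * (1 - ‖z‖) ≤ ‖1 - inner ℂ P.val z‖} := by
    ext P
    simp only [boundedSet, mem_ofPred_eq, mem_iInter, and_imp]
    refine forall₂_congr fun z hz => ?_
    rw [← not_lt (a := ‖1 - inner ℂ P.val z‖), ← not_lt (a := M)]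
    tauto
  rw [this]
  refine isClosed_biInter fun z _ => isClosed_le continuous_const ?_
  have := continuous_val (V := V)
  fun_prop

theorem norm_smul_val (P : KoranyiSphere V) {r : ℝ} (hr : 0 ≤ r) : ‖(r : ℂ) • P.val‖ = r := by
  rw [norm_smul, P.norm_val, mul_one, Complex.norm_real, Real.norm_eq_abs, abs_of_nonneg hr]

theorem isClosed_radialSet (hf : DifferentiableOn ℂ f (Metric.ball 0 1)) (c : ℂ) (ε : ℝ) {r₀ : ℝ}
    (hr : 0 ≤ r₀) : IsClosed (radialSet f c ε r₀) := by
  have : radialSet f c ε r₀ = ⋂ r ∈ Ico r₀ 1, {P | ‖f ((r : ℂ) • P.val) - c‖ ≤ ε} := by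
    ext P; simp [radialSet]
  rw [this]
  refine isClosed_biInter fun r hr' => isClosed_le ?_ continuous_const
  have h1 : Continuous fun P : KoranyiSphere V => (r : ℂ) • P.val :=
    continuous_val.const_smul _
  have h2 : Continuous fun P : KoranyiSphere V => f ((r : ℂ) • P.val) :=
    hf.continuousOn.comp_continuous h1 fun P => by
      rw [mem_ball_zero_iff, P.norm_smul_val (hr.trans hr'.1)]
      exact hr'.2
  exact (h2.sub continuous_const).norm

section Radial

variable [MeasurableSpace V] [BorelSpace V] [FiniteDimensional ℝ V] [Nontrivial V]
  (μ : Measure V) [μ.IsAddHaarMeasure]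

/-- At almost every point at which `f` is admissibly bounded, `f` is radially close to one of the
values of a given dense sequence. -/
theorem ae_mem_radialSet (hf : DifferentiableOn ℂ f (Metric.ball 0 1)) {α : ℝ} (hα : 1 < α) (M : ℝ)
    {ε : ℝ} (hε : 0 < ε) : ∀ᵐ P ∂surface μ, P ∈ boundedSet f α M →
      ∃ i j : ℕ, P ∈ radialSet f (TopologicalSpace.denseSeq ℂ i) ε (1 - 1 / (j + 1)) := by
  set R : Set (KoranyiSphere V) :=
    ⋃ (i : ℕ) (j : ℕ), radialSet f (TopologicalSpace.denseSeq ℂ i) ε (1 - 1 / (j + 1)) with hR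
  have hr0 : ∀ j : ℕ, (0 : ℝ) ≤ 1 - 1 / (j + 1) := fun j => by
    rw [sub_nonneg, div_le_one (by positivity)]
    linarith [j.cast_nonneg (α := ℝ)]
  have hRm : MeasurableSet R := MeasurableSet.iUnion fun i => MeasurableSet.iUnion fun j =>
    (isClosed_radialSet hf _ _ (hr0 j)).measurableSet
  have hNm : MeasurableSet (boundedSet f α M \ R) :=
    (isClosed_boundedSet f α M).measurableSet.diff hRm
  have hnull : surface μ (boundedSet f α M \ R) = 0 := by
    rw [surface_eq_zero_iff μ hNm]
    refine measure_mono_null inter_subset_left ?_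
    -- It suffices to work on one circle orbit, where `f` restricts to a function on a disc and its
    -- admissible regions to Stolz regions.
    refine measure_eq_zero_of_circle μ (measurableSet_sector hNm) fun v => ?_
    rcases eq_or_ne v 0 with rfl | hv
    · convert measure_empty (μ := volume)
      ext θ
      simp only [smul_zero, mem_ofPred_eq, mem_empty_iff_false, iff_false]
      exact fun h => ne_zero_of_mem_sector h rfl
    set P := direction v hv
    let Q : ℝ → KoranyiSphere V := fun θ => ⟨Complex.exp (Complex.I * θ) • P.val, by
      rw [mem_sphere_zero_iff_norm, norm_smul, P.norm_val, mul_one, mul_comm,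
        Complex.norm_exp_ofReal_mul_I]⟩
    have hQ : ∀ θ, (Q θ).val = Complex.exp (Complex.I * θ) • P.val := fun θ => rfl
    have hg : DifferentiableOn ℂ (fun l : ℂ => f (l • P.val)) (Metric.ball 0 1) := by
      refine hf.comp (f := fun l : ℂ => l • P.val) (by fun_prop) fun l hl => ?_
      rw [mem_ball_zero_iff] at hl ⊢
      rwa [norm_smul, P.norm_val, mul_one]
    have hrad := ae_tendsto_radial_of_bounded_on_stolz hg hα (M := M)
      (K := {θ | Q θ ∈ boundedSet f α M}) (by
        intro θ hθ z hz hz2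
        rw [mem_ball_zero_iff] at hz
        have hn : ‖z • P.val‖ = ‖z‖ := by rw [norm_smul, P.norm_val, mul_one]
        refine hθ (z • P.val) (by rwa [mem_ball_zero_iff, hn]) ?_
        rw [hn, hQ, inner_smul_left, inner_smul_right, P.inner_self, mul_one,
          ← Complex.exp_conj, map_mul, Complex.conj_I, Complex.conj_ofReal, neg_mul]
        exact hz2)
    rw [← compl_mem_ae_iff]
    filter_upwards [hrad] with θ hθ hmem
    obtain ⟨P', hP', hP'v⟩ : Complex.exp (θ * Complex.I) • v ∈ sector (boundedSet f α M \ R) := hmem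
    have hPQ : P' = Q θ := by
      apply Subtype.ext
      change P'.val = _
      rw [hP'v, norm_smul, Complex.norm_exp_ofReal_mul_I, one_mul, smul_comm, mul_comm]
      rfl
    subst hPQ
    obtain ⟨l, hl⟩ := hθ hP'.1
    refine hP'.2 ?_
    obtain ⟨i, hi⟩ := (TopologicalSpace.denseRange_denseSeq ℂ).exists_dist_lt l (half_pos hε)
    have hev := (Metric.tendsto_nhds.1 hl) (ε / 2) (half_pos hε)
    obtain ⟨r₁, hr₁, hr₁'⟩ := mem_nhdsLT_iff_exists_Ioo_subset.1 hev
    obtain ⟨j, hj⟩ := exists_nat_one_div_lt (show 0 < 1 - r₁ from sub_pos.2 hr₁)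
    refine mem_iUnion.2 ⟨i, mem_iUnion.2 ⟨j, fun r hr => ?_⟩⟩
    have h1 : dist (f ((r * Complex.exp (Complex.I * θ)) • P.val)) l < ε / 2 :=
      hr₁' ⟨by linarith [hr.1], hr.2⟩
    rw [hQ, smul_smul, ← dist_eq_norm]
    exact (dist_triangle _ l _).trans (by linarith)
  rw [← compl_mem_ae_iff] at hnull
  filter_upwards [hnull] with P hP hPb
  by_contra hcon
  refine hP ⟨hPb, fun hPR => hcon ?_⟩
  simpa [hR] using hPR

end Radial

/-! ### From radial to admissible limits at density points. -/

section Density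

/-- A point at height `h` in an admissible region projects to a point within `O(√h)` of the vertex.
Density at radii of order `√h` thus applies to balls about that projection. -/
theorem dist_direction_le {P : KoranyiSphere V} {z : V} (hz0 : z ≠ 0) (hz1 : ‖z‖ ≤ 1) {β : ℝ}
    (hβ : 0 ≤ β) (hz : ‖1 - inner ℂ P.val z‖ ≤ β * (1 - ‖z‖)) :
    dist P (direction z hz0) ≤ √(β + 1) * √(1 - ‖z‖) := by
  rw [dist_le_iff (by positivity), mul_pow, Real.sq_sqrt (by linarith),
    Real.sq_sqrt (by linarith), val_direction]
  exact (norm_one_sub_inner_normalize_le P.norm_val hz0 hz1).trans (by linarith)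

theorem tendsto_const_mul_sqrt {κ : ℝ} (hκ : 0 < κ) :
    Tendsto (fun h => κ * √h) (𝓝[>] 0) (𝓝[>] 0) := by
  apply tendsto_nhdsWithin_of_tendsto_nhds_of_eventually_within
  · apply tendsto_nhdsWithin_of_tendsto_nhds
    have : Continuous fun h : ℝ => κ * √h := by fun_prop
    simpa using this.tendsto 0
  · filter_upwards [self_mem_nhdsWithin] with h hh
    exact mul_pos hκ (Real.sqrt_pos.2 hh)

/-- If `f` is bounded on the admissible regions of a fixed aperture at the points of a set `S`, it
is bounded on the admissible regions of any aperture, near the density points of `S`. -/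
theorem eventually_norm_le_of_density {P : KoranyiSphere V} {S : Set (KoranyiSphere V)} {α M : ℝ}
    (hα : 1 < α) (hS : S ⊆ boundedSet f α M)
    (hne : ∀ C : ℝ, ∀ᶠ r in 𝓝[>] (0 : ℝ), ∀ y, dist P y ≤ C * r →
      (S ∩ Metric.closedBall y r).Nonempty) {β : ℝ} (hβ : 0 ≤ β) :
    ∀ᶠ h in 𝓝[>] (0 : ℝ), ∀ z : V, 1 - ‖z‖ = h → ‖1 - inner ℂ P.val z‖ < β * h → ‖f z‖ ≤ M := by
  have hα1 : 1 < √α := by rw [Real.lt_sqrt (by norm_num)]; simpa using hα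
  set κ := (√α - 1) / 2 with hκ
  have hκ0 : 0 < κ := by rw [hκ]; linarith
  -- With `Q` in `S` within `κ * √h` of the direction of `z`, the triangle inequality gives `(κ + 1)
  -- * √h < √α * √h`, so `z` lies in the region over `Q`.
  filter_upwards [(tendsto_const_mul_sqrt hκ0).eventually (hne (√(β + 1) / κ)),
    Ioo_mem_nhdsGT one_pos] with h hh h01 z hz hzP
  have hz1 : ‖z‖ < 1 := by linarith [h01.1]
  have hzpos : 0 < ‖z‖ := by linarith [h01.2]
  have hz0 : z ≠ 0 := norm_pos_iff.1 hzpos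
  have hd := dist_direction_le hz0 hz1.le hβ (P := P) (by rw [hz]; exact hzP.le)
  rw [hz] at hd
  obtain ⟨Q, hQS, hQ⟩ := hh (direction z hz0) (hd.trans (le_of_eq (by field_simp)))
  refine hS hQS z (by simpa using hz1) ?_
  have h1 := sqrt_norm_one_sub_inner_le Q.norm_val.le (direction z hz0).norm_val hz1.le
  have h2 : inner ℂ (direction z hz0).val z = (‖z‖ : ℂ) := by
    rw [val_direction, ← Complex.coe_smul, inner_smul_left, inner_self_eq_norm_sq_to_K]
    have : (‖z‖ : ℂ) ≠ 0 := by exact_mod_cast hzpos.ne'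
    simp
    field_simp
  have h3 : ‖(1 : ℂ) - ‖z‖‖ = h := by
    rw [← Complex.ofReal_one, ← Complex.ofReal_sub, Complex.norm_real, Real.norm_eq_abs, hz,
      abs_of_pos h01.1]
  rw [h2, h3] at h1
  have h4 : √‖1 - inner ℂ Q.val (direction z hz0).val‖ ≤ κ * √h := hQ
  have hsh : 0 < √h := Real.sqrt_pos.2 h01.1
  have h5 : √‖1 - inner ℂ Q.val z‖ < √α * √h := by
    have : (κ + 1) * √h < √α * √h := by gcongr; rw [hκ]; linarith
    linarith
  rw [← Real.sqrt_mul (by linarith)] at h5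
  rw [hz]
  exact lt_of_not_ge fun hle => h5.not_ge (Real.sqrt_le_sqrt hle)

variable [MeasurableSpace V] [BorelSpace V] [FiniteDimensional ℝ V] [Nontrivial V]
  (μ : Measure V) [μ.IsAddHaarMeasure]

/-- Near a density point of a set on which `f` is radially `ε`-close to `c`, and on the admissible
regions over which `f` is bounded, `f` is `2ε`-close to `c` on all admissible regions. -/
theorem eventually_norm_sub_le_of_density (hf : DifferentiableOn ℂ f (Metric.ball 0 1))
    {P : KoranyiSphere V} {S : Set (KoranyiSphere V)} (hSm : MeasurableSet S) {α M ε r₀ : ℝ} {c : ℂ}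
    (hα : 1 < α) (hε : 0 < ε) (hr₀ : r₀ < 1) (hS : S ⊆ boundedSet f α M ∩ radialSet f c ε r₀)
    (hne : ∀ C : ℝ, ∀ᶠ r in 𝓝[>] (0 : ℝ), ∀ y, dist P y ≤ C * r →
      (S ∩ Metric.closedBall y r).Nonempty)
    (hdens : ∀ C : ℝ, ∀ η > (0 : ℝ), ∀ᶠ r in 𝓝[>] (0 : ℝ), ∀ y, dist P y ≤ C * r →
      (surface μ).real (Metric.closedBall y r \ S) ≤
        η * (surface μ).real (Metric.closedBall y r)) {β : ℝ} (hβ : 0 ≤ β) :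
    ∀ᶠ h in 𝓝[>] (0 : ℝ), ∀ z : V, 1 - ‖z‖ = h → ‖1 - inner ℂ P.val z‖ < β * h →
      ‖f z - c‖ ≤ 2 * ε := by
  set C := √(β + 1) + √2 with hC
  -- Points of the ellipsoid about `z` are within `C * √h` of `P` and have height at least `h / 2`,
  -- so this aperture contains them all.
  have hbdd := eventually_norm_le_of_density hα (fun Q hQ => (hS hQ).1) hne
    (β := 2 * C ^ 2 + 1) (by positivity)
  obtain ⟨h₁, hh₁, hbdd⟩ := mem_nhdsGT_iff_exists_Ioo_subset.1 hbdd
  set d := Module.finrank ℝ V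
  set b := μ.real (Metric.ball (0 : V) 1)
  have hb : 0 < b := measureReal_ball_pos μ
  set C' : ℝ := d * 4 ^ d * (8 ^ 2) ^ d / 2 with hC'
  have hC'0 : 0 ≤ C' := by positivity
  set M' := |M| + ‖c‖ + 1 with hM'
  have hM'0 : 0 < M' := by positivity
  -- Chosen so that the exceptional set, of proportion at most `η * C'` in the ellipsoid,
  -- contributes at most `ε` to the mean of a function bounded by `M'`.
  set η := ε / (M' * (C' + 1)) with hη
  have hη0 : 0 < η := by positivity
  have hmin : 0 < min (min (h₁ / 2) (1 / 16)) ((1 - r₀) / 2) := by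
    have : 0 < 1 - r₀ := by linarith
    have : 0 < h₁ := hh₁
    positivity
  filter_upwards [(tendsto_const_mul_sqrt two_pos).eventually (hdens (√(β + 1) / 2) η hη0),
    Ioo_mem_nhdsGT hmin] with h hdh hh z hz hzP
  obtain ⟨h0, hlt⟩ := hh
  have l1 : 2 * h < h₁ := by
    have := hlt.trans_le ((min_le_left _ _).trans (min_le_left _ _)); linarith
  have l2 : h < 1 / 16 := hlt.trans_le ((min_le_left _ _).trans (min_le_right _ _))
  have l3 : 2 * h ≤ 1 - r₀ := by
    have := hlt.trans_le (min_le_right _ _); linarith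
  have hz1 : ‖z‖ < 1 := by linarith
  have hzpos : 0 < ‖z‖ := by linarith
  have hz0 : z ≠ 0 := norm_pos_iff.1 hzpos
  set ζ := direction z hz0 with hζ
  have hd := dist_direction_le hz0 hz1.le hβ (P := P) (by rw [hz]; exact hzP.le)
  rw [hz] at hd
  have hsh : 0 < √h := Real.sqrt_pos.2 h0
  have hdh := hdh ζ (hd.trans (le_of_eq (by field_simp)))
  have hzζ : z = ((1 - h : ℝ) : ℂ) • ζ.val := by
    rw [← hz, sub_sub_cancel, hζ, val_direction, Complex.coe_smul, smul_smul,
      mul_inv_cancel₀ hzpos.ne', one_smul]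
  let A : V → V := fun v => z + anisotropicDilation ζ.val (√h / 4) v
  have hAshell : ∀ v ∈ Metric.ball (0 : V) 1, A v ∈ shell (Metric.closedBall ζ (2 * √h)) (2 * h) := by
    intro v hv
    have := mem_shell_of_ellipsoid ζ h0 (by linarith) (by simpa using hv : ‖v‖ < 1)
    rwa [← hzζ] at this
  have hAcont : Continuous A := by fun_prop
  have hbound : ∀ v ∈ Metric.ball (0 : V) 1, ‖f (A v) - c‖ ≤ M' := by
    intro v hv
    obtain ⟨e1, e2, e3⟩ := ellipsoid_estimates ζ.norm_val h0 (by linarith)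
      (by simpa using (mem_ball_zero_iff.1 hv).le : ‖v‖ ≤ 1) (w := A v) (by simp only [A]; rw [← hzζ])
    have hfM : ‖f (A v)‖ ≤ M := by
      refine hbdd (show 1 - ‖A v‖ ∈ Ioo 0 h₁ from ⟨by linarith, by linarith⟩) (A v) rfl ?_
      have t := sqrt_norm_one_sub_inner_le P.norm_val.le ζ.norm_val (c := A v) (by linarith)
      have t1 : √‖1 - inner ℂ P.val ζ.val‖ ≤ √(β + 1) * √h := hd
      have t2 : √‖1 - inner ℂ ζ.val (A v)‖ ≤ √2 * √h := by
        rw [← Real.sqrt_mul (by norm_num)]; exact Real.sqrt_le_sqrt e3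
      have t3 : √‖1 - inner ℂ P.val (A v)‖ ≤ C * √h := by rw [hC, add_mul]; linarith
      rw [Real.sqrt_le_left (by positivity), mul_pow, Real.sq_sqrt h0.le] at t3
      nlinarith [sq_nonneg C]
    calc _ ≤ ‖f (A v)‖ + ‖c‖ := norm_sub_le _ _
      _ ≤ M' := by rw [hM']; linarith [le_abs_self M]
  have hclose : ∀ v ∈ Metric.ball (0 : V) 1, A v ∈ sector S → ‖f (A v) - c‖ ≤ ε := by
    rintro v hv ⟨Q, hQ, hQv⟩
    obtain ⟨-, hA1, hA2⟩ := hAshell v hv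
    have hpos : 0 < ‖A v‖ := by linarith
    have : A v = ((‖A v‖ : ℝ) : ℂ) • Q.val := by
      rw [hQv, Complex.coe_smul, smul_smul, mul_inv_cancel₀ hpos.ne', one_smul]
    rw [this]
    exact (hS hQ).2 _ ⟨by linarith, hA2⟩
  have hgd : DifferentiableOn ℂ (fun v => f (A v) - c) (Metric.ball 0 1) := by
    refine (hf.comp (f := A) (by fun_prop) fun v hv => ?_).sub_const c
    simpa using (hAshell v hv).2.2
  have hT : MeasurableSet (A ⁻¹' sector S)ᶜ := (hAcont.measurable (measurableSet_sector hSm)).compl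
  have hmean := norm_mul_measureReal_ball_le μ hgd hε.le hM'0.le hT
    (fun v hv hvT => hclose v hv (by simpa using hvT)) hbound
  have hA0 : A 0 = z := by simp [A]
  rw [hA0] at hmean
  have hfactor : 0 < dilationFactor ζ.val (√h / 4) := dilationFactor_pos ζ.norm_val (by positivity)
  -- The bad points of the ellipsoid lie in the shell over the part of the Korányi ball outside `S`.
  -- Its volume is compared with that of the ellipsoid; the dilations `2 * √h` and `√h / 4` have
  -- ratio 8.
  have hbad : μ.real (Metric.ball 0 1 ∩ (A ⁻¹' sector S)ᶜ) ≤ η * C' * b := by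
    refine le_of_mul_le_mul_left ?_ hfactor
    have hsub : anisotropicDilation ζ.val (√h / 4) '' (Metric.ball 0 1 ∩ (A ⁻¹' sector S)ᶜ) ⊆
        (fun x => z + x) ⁻¹' shell (Metric.closedBall ζ (2 * √h) \ S) (2 * h) := by
      rintro _ ⟨v, ⟨hv, hvS⟩, rfl⟩
      obtain ⟨⟨Q, hQ, hQv⟩, hv2⟩ := hAshell v hv
      exact ⟨⟨Q, ⟨hQ, fun hQS => hvS ⟨Q, hQS, hQv⟩⟩, hQv⟩, hv2⟩
    have u := surface_closedBall_le μ ζ (δ := 2 * √h) (by positivity) (by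
      have : √h < 1 / 4 := by
        rw [Real.sqrt_lt' (by norm_num)]; linarith
      linarith)
    rw [mul_pow, Real.sq_sqrt h0.le] at u
    calc _ = μ.real (anisotropicDilation ζ.val (√h / 4) ''
          (Metric.ball 0 1 ∩ (A ⁻¹' sector S)ᶜ)) := (measureReal_image_anisotropicDilation _ _ _ _).symm
      _ ≤ μ.real ((fun x => z + x) ⁻¹' shell (Metric.closedBall ζ (2 * √h) \ S) (2 * h)) :=
          measureReal_mono hsub (by rw [measure_preimage_add]; exact measure_shell_ne_top _ _ _)
      _ = μ.real (shell (Metric.closedBall ζ (2 * √h) \ S) (2 * h)) := measureReal_preimage_add _ _ _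
      _ ≤ 2 * h * (surface μ).real (Metric.closedBall ζ (2 * √h) \ S) :=
          measureReal_shell_le μ (Metric.isClosed_closedBall.measurableSet.diff hSm) (by positivity)
            (by linarith)
      _ ≤ 2 * h * (η * (surface μ).real (Metric.closedBall ζ (2 * √h))) := by gcongr
      _ = η / 2 * (2 ^ 2 * h * (surface μ).real (Metric.closedBall ζ (2 * √h))) := by ring
      _ ≤ η / 2 * (d * (dilationFactor ζ.val (2 * √h) * (4 ^ d * b))) := by gcongr
      _ ≤ η / 2 * (d * (((8 ^ 2) ^ d * dilationFactor ζ.val (√h / 4)) * (4 ^ d * b))) := by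
          gcongr
          rw [show 2 * √h = 8 * (√h / 4) by ring, dilationFactor_mul ζ.norm_val]
          gcongr
          exact dilationFactor_le μ ζ.norm_val (by norm_num)
      _ = _ := by rw [hC']; ring
  have hηC : M' * (η * C') ≤ ε := by
    rw [hη]
    rw [show M' * (ε / (M' * (C' + 1)) * C') = ε * (C' / (C' + 1)) by field_simp]
    have : C' / (C' + 1) ≤ 1 := by rw [div_le_one (by positivity)]; linarith
    nlinarith
  refine le_of_mul_le_mul_right ?_ hb
  calc _ ≤ _ := hmean
    _ ≤ ε * b + M' * (η * C' * b) := by gcongr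
    _ = ε * b + M' * (η * C') * b := by ring
    _ ≤ ε * b + ε * b := by gcongr
    _ = _ := by ring

/-- The local Fatou theorem for admissible limits, with respect to surface measure. -/
theorem ae_exists_admissible_limit (hf : DifferentiableOn ℂ f (Metric.ball 0 1)) :
    ∀ᵐ P ∂surface μ, (∃ α, 1 < α ∧ ∃ M, P ∈ boundedSet f α M) → ∀ β, ∃ l,
      Tendsto f (𝓝[{z | z ∈ Metric.ball 0 1 ∧ ‖1 - inner ℂ P.val z‖ < β * (1 - ‖z‖)}] P.val)
        (𝓝 l) := by
  -- Apertures decreasing to 1 paired with bounds `k`: every point of admissible boundedness lies in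
  -- one of countably many sets.
  let α : ℕ → ℝ := fun k => 1 + 1 / (k + 1)
  have hα : ∀ k, 1 < α k := fun k => by simp only [α]; linarith [Nat.one_div_pos_of_nat (α := ℝ) (n := k)]
  let ε : ℕ → ℝ := fun m => 1 / (m + 1)
  have hε : ∀ m, 0 < ε m := fun m => Nat.one_div_pos_of_nat
  let S : ℕ → ℕ → ℕ → ℕ → Set (KoranyiSphere V) := fun k m i j => boundedSet f (α k) k ∩
    radialSet f (TopologicalSpace.denseSeq ℂ i) (ε m) (1 - 1 / (j + 1))
  have hSm : ∀ k m i j, MeasurableSet (S k m i j) := fun k m i j =>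
    ((isClosed_boundedSet _ _ _).inter (isClosed_radialSet hf _ _ (by
      rw [sub_nonneg, div_le_one (by positivity)]
      linarith [j.cast_nonneg (α := ℝ)]))).measurableSet
  have a1 := ae_all_iff.2 fun k => ae_all_iff.2 fun m => ae_mem_radialSet μ hf (hα k) k (hε m)
  have a2 := ae_all_iff.2 fun k => ae_all_iff.2 fun m => ae_all_iff.2 fun i => ae_all_iff.2 fun j =>
    ae_eventually_inter_closedBall_nonempty (surface μ) (S k m i j)
  have a3 := ae_all_iff.2 fun k => ae_all_iff.2 fun m => ae_all_iff.2 fun i => ae_all_iff.2 fun j =>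
    ae_eventually_measureReal_diff_le (surface μ) (hSm k m i j)
  filter_upwards [a1, a2, a3] with P h1 h2 h3
  rintro ⟨α₀, hα₀, M, hP⟩ β
  obtain ⟨k₁, hk₁⟩ := exists_nat_one_div_lt (sub_pos.2 hα₀)
  obtain ⟨k₂, hk₂⟩ := exists_nat_ge M
  set k := max k₁ k₂ with hk
  have hPk : P ∈ boundedSet f (α k) k := by
    intro z hz hzP
    have hz1 : ‖z‖ < 1 := by simpa using hz
    have hαk : α k ≤ α₀ := by
      have : (1 : ℝ) / (k + 1) ≤ 1 / (k₁ + 1) := by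
        gcongr; exact le_max_left _ _
      simp only [α]; linarith
    refine (hP z hz (hzP.trans_le (by gcongr))).trans (hk₂.trans ?_)
    exact_mod_cast le_max_right _ _
  set l := 𝓝[{z | z ∈ Metric.ball 0 1 ∧ ‖1 - inner ℂ P.val z‖ < β * (1 - ‖z‖)}] P.val with hl
  -- If the region does not accumulate at `P`, any value is a limit.
  rcases l.eq_or_neBot with hbot | hbot
  · exact ⟨0, by rw [hbot]; exact tendsto_bot⟩
  have hheight : Tendsto (fun z : V => 1 - ‖z‖) l (𝓝[>] 0) := by
    apply tendsto_nhdsWithin_of_tendsto_nhds_of_eventually_within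
    · apply tendsto_nhdsWithin_of_tendsto_nhds
      have : Continuous fun z : V => 1 - ‖z‖ := by fun_prop
      simpa [P.norm_val] using this.tendsto P.val
    · filter_upwards [self_mem_nhdsWithin] with z hz
      simpa using hz.1
  have hclose : ∀ m, ∃ c, ∀ᶠ z in l, ‖f z - c‖ ≤ 2 * ε m := by
    intro m
    obtain ⟨i, j, hij⟩ := h1 k m hPk
    refine ⟨TopologicalSpace.denseSeq ℂ i, ?_⟩
    have key := eventually_norm_sub_le_of_density μ hf (hSm k m i j) (hα k) (hε m)
      (show (1 : ℝ) - 1 / (j + 1) < 1 by linarith [Nat.one_div_pos_of_nat (α := ℝ) (n := j)])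
      subset_rfl (h2 k m i j ⟨hPk, hij⟩) (h3 k m i j ⟨hPk, hij⟩) (abs_nonneg β)
    filter_upwards [hheight.eventually key, self_mem_nhdsWithin] with z hz hz2
    have hz1 : ‖z‖ < 1 := by simpa using hz2.1
    exact hz z rfl (hz2.2.trans_le (by gcongr; exact le_abs_self β))
  refine cauchy_map_iff_exists_tendsto.1 (Metric.cauchy_iff.2 ⟨hbot.map f, fun δ hδ => ?_⟩)
  obtain ⟨m, hm⟩ := exists_nat_one_div_lt (show 0 < δ / 4 by positivity)
  obtain ⟨c, hc⟩ := hclose m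
  refine ⟨{w | ‖w - c‖ ≤ 2 * ε m}, hc, fun x hx y hy => ?_⟩
  have hm' : ε m < δ / 4 := hm
  rw [mem_ofPred_eq, ← dist_eq_norm] at hx hy
  exact (dist_triangle_right x y c).trans_lt (by linarith)

open scoped Pointwise in
-- Surface measure is defined through the volume of cones, so a null set spans a null cone; a
-- measurable null superset is taken since `N` need not be measurable.
theorem hausdorffMeasure_val_image_eq_zero {N : Set (KoranyiSphere V)} (hN : surface μ N = 0)
    {m : ℕ} (hm : Module.finrank ℝ V = m + 1) : μH[(m : ℝ)] (val '' N) = 0 := by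
  obtain ⟨T, hNT, hTm, hT⟩ := exists_measurable_superset_of_null hN
  refine measure_mono_null (image_mono hNT) (hausdorffMeasure_eq_zero_of_cone_null μ hm ?_ ?_)
  · rintro _ ⟨P, -, rfl⟩
    simpa using P.norm_val
  · rw [Ioo_smul_eq_sector_inter_ball]
    exact (surface_eq_zero_iff μ hTm).1 hT

end Density

end KoranyiSphere

/-! ### The theorem for Hausdorff measure. -/

theorem theorem10 (n : ℕ) (f : EuclideanSpace ℂ (Fin n) → ℂ)
    (hf : DifferentiableOn ℂ f (Metric.ball (0 : EuclideanSpace ℂ (Fin n)) 1))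
    (E : Set (EuclideanSpace ℂ (Fin n)))
    (hE : E ⊆ Metric.sphere (0 : EuclideanSpace ℂ (Fin n)) 1)
    (hEpos : 0 < μH[2 * (n : ℝ) - 1] E)
    (hbdd : ∀ᵐ P ∂(μH[2 * (n : ℝ) - 1] : Measure (EuclideanSpace ℂ (Fin n))),
      P ∈ E → AdmissiblyBoundedAt f P) :
    ∀ᵐ P ∂(μH[2 * (n : ℝ) - 1] : Measure (EuclideanSpace ℂ (Fin n))),
      P ∈ E → HasAdmissibleLimitAt f P := by
  -- For `n = 0` the sphere is empty and could not contain a set of positive measure. Hence the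
  -- space is nontrivial and `2 * n - 1` is a natural number `m`.
  have hn : n ≠ 0 := by
    rintro rfl
    obtain ⟨P, hP⟩ := nonempty_of_measure_ne_zero hEpos.ne'
    have h1 := mem_sphere_zero_iff_norm.1 (hE hP)
    rw [Subsingleton.elim P 0, norm_zero] at h1
    exact zero_ne_one h1
  have : Nonempty (Fin n) := ⟨⟨0, Nat.pos_of_ne_zero hn⟩⟩
  obtain ⟨m, hm⟩ : ∃ m, 2 * n = m + 1 := ⟨2 * n - 1, by omega⟩
  have hdim : Module.finrank ℝ (EuclideanSpace ℂ (Fin n)) = m + 1 := by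
    rw [finrank_real_of_complex, finrank_euclideanSpace_fin, hm]
  have hreal : 2 * (n : ℝ) - 1 = m := by
    have : 2 * (n : ℝ) = m + 1 := by exact_mod_cast hm
    linarith
  rw [hreal] at hbdd ⊢
  have hnull := KoranyiSphere.hausdorffMeasure_val_image_eq_zero volume
    (KoranyiSphere.ae_exists_admissible_limit volume hf) hdim
  rw [← compl_mem_ae_iff] at hnull
  filter_upwards [hbdd, hnull] with P hP hPN hPE
  by_contra hcon
  refine hPN ⟨⟨P, hE hPE⟩, fun hlim => hcon ?_, rfl⟩
  obtain ⟨α, hα, M, hM⟩ := hP hPE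
  intro β _
  exact hlim ⟨α, hα, M, fun z hz hz2 => hM z ⟨hz, hz2⟩⟩ β
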